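/- Let $N\ge 2$ and let $J_N$ be the $N\times N$ complex matrix with $1$'s on the superdiagonal and $0$'s elsewhere. Let $P_{J_N}$ be its numerical shadow, i.e. the law on $\mathbb{C}$ of $u^*J_Nu$ when $u$ is distributed uniformly on the unit sphere of $\mathbb{C}^N$. Write $(a)_m=a(a+1)\cdots(a+m-1)$, $(a)_0=1$. Define $F_N$ on $(0,1)$ by $F_2(x)=\frac{1}{2\sqrt{1-x}}$ and, for $N\ge 3$, by $$F_N(x)=\int_x^1 f(s)\,g\!\left(\frac xs\right)\frac{ds}{s},\qquad f(x)=\frac{N-1}{2}(1-x)^{\frac{N-3}{2}},\quad g(x)=\frac{N-2}{2}(1-x)^{\frac{N-4}{2}},$$ and put $F_N=0$ outside $(0,1)$. 1. The measure $P_{J_N}$ is invariant under all rotations of $\mathbb{C}$ about $0$, and it has a density with respect to planar Lebesgue measure, given for almost every $z$ by $f_N(|z|)$, where $$f_N(r)=\frac1\pi\sum_{k=1}^{\lfloor N/2\rfloor}(-1)^{k-1}\,\frac{2^{N+1}}{N+1}\,\sin^2\!\frac{k\pi}{N+1}\,\Bigl(\cos\frac{k\pi}{N+1}\Bigr)^{N-3}\,F_N\!\left(\frac{r^2}{\cos^2\frac{k\pi}{N+1}}\right).$$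 2. The function $F_N$ is, up to equality almost everywhere, the unique probability density on $[0,1]$ with moments $$\int_0^1x^mF_N(x)\,dx=\frac{(m!)^2}{\left(\frac N2\right)_m\left(\frac{N+1}2\right)_m}\qquad(m=0,1,2,\dots).$$ 3. For $0<x<1$, $$F_N(x)=\frac{\Gamma\left(\frac N2\right)\Gamma\left(\frac{N+1}2\right)}{\Gamma\left(N-\frac32\right)}\,(1-x)^{N-\frac52}\;{}_2F_1\!\left(\tfrac{N-1}2,\tfrac{N-2}2;N-\tfrac32;1-x\right).$$ -/

import Mathlib

open MeasureTheory

noncomputable section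

namespace NumericalShadow

/-- The unit sphere `Ω_N` of `ℂ^N` (with the Euclidean norm). -/
abbrev UnitSphere (N : ℕ) : Type := Metric.sphere (0 : EuclideanSpace ℂ (Fin N)) 1

/-- The uniform probability measure on the unit sphere of `ℂ^N`: the surface measure attached to
Lebesgue measure on `ℂ^N ≃ ℝ^{2N}`, divided by its total mass. -/
def sphereMeasure (N : ℕ) : Measure (UnitSphere N) :=
  ((volume : Measure (EuclideanSpace ℂ (Fin N))).toSphere Set.univ)⁻¹ •
    (volume : Measure (EuclideanSpace ℂ (Fin N))).toSphere

/-- The value `(Mu, u) = u^* M u` of the quadratic form of `M` at a unit vector `u`. -/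
def quadForm {N : ℕ} (M : Matrix (Fin N) (Fin N) ℂ) (u : UnitSphere N) : ℂ :=
  star (u.1.ofLp) ⬝ᵥ M.mulVec u.1.ofLp

/-- The numerical shadow `P_M`: the law of `(Mu, u)` when `u` is uniform on the unit sphere,
regarded as a Borel measure on `ℂ`. -/
def shadow {N : ℕ} (M : Matrix (Fin N) (Fin N) ℂ) : Measure ℂ :=
  (sphereMeasure N).map (quadForm M)

/-- The Jordan nilpotent `J_N`: ones on the superdiagonal, zeros elsewhere. -/
def jordanNilpotent (N : ℕ) : Matrix (Fin N) (Fin N) ℂ :=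
  Matrix.of fun i j => if (i : ℕ) + 1 = (j : ℕ) then 1 else 0

/-- `P` is invariant under all rotations of the plane about `0`. -/
def IsRotationInvariant (P : Measure ℂ) : Prop :=
  ∀ θ : ℝ, P.map (fun z : ℂ => Complex.exp (θ * Complex.I) * z) = P

/-- `P` has the real-valued function `f` as a density with respect to planar Lebesgue measure. -/
def HasPlanarDensity (P : Measure ℂ) (f : ℂ → ℝ) : Prop :=
  Integrable f ∧ (∀ᵐ z : ℂ, 0 ≤ f z) ∧ P = volume.withDensity fun z => ENNReal.ofReal (f z)

/-- The beta density `β (1 - x)^(β - 1)` on `(0, 1)`. -/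
def betaDensity (β x : ℝ) : ℝ := β * (1 - x) ^ (β - 1)

/-- The density at `x` of the product of independent `[0, 1]`-valued variables with
densities `f` and `g`. -/
def mulConv (f g : ℝ → ℝ) (x : ℝ) : ℝ := ∫ s in x..1, f s * g (x / s) / s

/-- The building block `F_N` (for `N ≥ 2`), extended by `0` outside `(0, 1)`. -/
def F (N : ℕ) (x : ℝ) : ℝ :=
  if 0 < x ∧ x < 1 then
    if N = 2 then betaDensity (1 / 2) x
    else mulConv (betaDensity (((N : ℝ) - 1) / 2)) (betaDensity (((N : ℝ) - 2) / 2)) x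
  else 0

/-- `f` is a probability density on `[0, 1]`. -/
def IsUnitIntervalDensity (f : ℝ → ℝ) : Prop :=
  IntegrableOn f (Set.Icc 0 1) ∧ (∀ᵐ x ∂(volume.restrict (Set.Icc (0 : ℝ) 1)), 0 ≤ f x) ∧
    ∫ x in Set.Icc (0 : ℝ) 1, f x = 1

/-- The moments of `f` on `[0, 1]` are `m!² / ((N/2)_m ((N+1)/2)_m)`, `m = 0, 1, 2, …`, where
`(a)_m = a (a + 1) ⋯ (a + m - 1)`. -/
def HasShadowMoments (N : ℕ) (f : ℝ → ℝ) : Prop :=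
  ∀ m : ℕ, ∫ x in Set.Icc (0 : ℝ) 1, x ^ m * f x =
    (m.factorial : ℝ) ^ 2 /
      ((ascPochhammer ℝ m).eval ((N : ℝ) / 2) * (ascPochhammer ℝ m).eval (((N : ℝ) + 1) / 2))

/-- The radial function `f_N(r)`. The exponent `N - 3` of the cosine is an integer, equal to `-1`
for `N = 2`. -/
def radialDensity (N : ℕ) (r : ℝ) : ℝ :=
  1 / Real.pi * ∑ k ∈ Finset.Icc 1 (N / 2),
    (-1 : ℝ) ^ (k - 1) * (2 ^ (N + 1) / ((N : ℝ) + 1)) *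
      Real.sin (k * Real.pi / ((N : ℝ) + 1)) ^ 2 *
      Real.cos (k * Real.pi / ((N : ℝ) + 1)) ^ ((N : ℤ) - 3) *
      F N (r ^ 2 / Real.cos (k * Real.pi / ((N : ℝ) + 1)) ^ 2)

end NumericalShadow

end

namespace NumericalShadow

/-! The characteristic function at `w` of a rotation invariant measure is that of its projection to
the real axis at `‖w‖`, so such a measure is determined by this projection. If its support is
bounded, the moments of `Re z` determine it. The density claim therefore reduces to comparing `∫ (Re
z)^n` for the shadow and for `f_N(|z|)`.

On the shadow side, `X = Re (u* J u)` is the form of the Hermitian matrix `H = (J + J*)/2`, whose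
eigenvalues are `cos θ_k`, `θ_k = kπ/(N+1)`. A Gaussian integral in polar coordinates gives `E (1 -
tX)^(-N) = ∏ (1 - t cos θ_k)⁻¹`. Split the product into partial fractions, with coefficients `c_k`
found from the derivative of the Chebyshev polynomial `U_N` at its roots, and compare powers of `t`:
`(N)_n / n! · E X^n = ∑ c_k cos^n θ_k` (`integral_re_quadForm_pow`).

On the density side, `F_N(|z|²/l²)` has `2m`-th real moment `π l^(2m+2) (2m)!/(N)_{2m}`
(`integral_F_mul_re_pow_even`): the moments of `F_N` are exactly those which, multiplied by the mean
of `cos^(2m)`, cancel the factor `(N)_n / n!` above. The indices `k` and `N+1-k` contribute equally,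
whence the half range of summation and the factor `2^(N+1)` instead of `2^N`; the area factor `l²`
lowers the exponent `N-1` of the cosine to `N-3`. Odd moments vanish by symmetry.

The sum for `f_N` has alternating signs, and its nonnegativity is not checked directly: it follows
from the equality of measures (`hasPlanarDensity_of_re_moments`).

For `F_N` itself, moments multiply under multiplicative convolution, and each beta density
contributes a factor `m!/(β+1)_m`. Uniqueness is the determinacy of bounded moment problems. The
substitution `s = 1 - (1-x)t` turns the convolution into Euler's integral for `₂F₁`. -/

/-! ### Determinacy: bounded moments and rotation invariance -/

open Complex in
lemma charFun_eq_tsum_moments (μ : Measure ℝ) [IsFiniteMeasure μ] {R : ℝ}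
    (hμ : ∀ᵐ x ∂μ, |x| ≤ R) (t : ℝ) :
    charFun μ t = ∑' n : ℕ, ((t : ℂ) * I) ^ n / n.factorial * ((∫ x, x ^ n ∂μ : ℝ) : ℂ) := by
  have h : HasSum (fun n : ℕ => ∫ x : ℝ, ((t * x : ℂ) * I) ^ n / n.factorial ∂μ)
      (∫ x : ℝ, Complex.exp ((t * x : ℂ) * I) ∂μ) := by
    -- The bounded support lets the exponential series of `|t| R` dominate termwise.
    refine hasSum_integral_of_dominated_convergence (fun n _ => (|t| * R) ^ n / n.factorial)
      (fun n => (by fun_prop : Measurable _).aestronglyMeasurable) (fun n => ?_)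
      (Filter.Eventually.of_forall fun x => Real.summable_pow_div_factorial _)
      (integrable_const _) (Filter.Eventually.of_forall fun x => ?_)
    · filter_upwards [hμ] with x hx
      have : ‖((t : ℂ) * x) * I‖ ≤ |t| * R := by
        simpa using mul_le_mul_of_nonneg_left hx (abs_nonneg t)
      rw [norm_div, norm_pow, Complex.norm_natCast]
      gcongr
    · rw [Complex.exp_eq_exp_ℂ]
      exact NormedSpace.expSeries_div_hasSum_exp _
  rw [charFun_apply_real, ← h.tsum_eq]
  refine tsum_congr fun n => ?_
  rw [← integral_complex_ofReal, ← integral_const_mul]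
  refine integral_congr_ae (Filter.Eventually.of_forall fun x => ?_)
  push_cast
  ring

/-- Two finite measures on the line with bounded support and the same moments are equal. -/
lemma ext_of_moments {μ ν : Measure ℝ} [IsFiniteMeasure μ] [IsFiniteMeasure ν] {R : ℝ}
    (hμ : ∀ᵐ x ∂μ, |x| ≤ R) (hν : ∀ᵐ x ∂ν, |x| ≤ R)
    (h : ∀ n : ℕ, ∫ x, x ^ n ∂μ = ∫ x, x ^ n ∂ν) : μ = ν := by
  refine Measure.ext_of_charFun (funext fun t => ?_)
  rw [charFun_eq_tsum_moments μ hμ, charFun_eq_tsum_moments ν hν]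
  simp_rw [h]

/-- Rotating the measure by `arg w` turns the pairing of `z` with `w` into `‖w‖ Re z`. -/
lemma charFun_of_isRotationInvariant {μ : Measure ℂ} (hμ : IsRotationInvariant μ) (w : ℂ) :
    charFun μ w = charFun (μ.map Complex.re) ‖w‖ := by
  rw [charFun_apply, charFun_apply_real, integral_map (by fun_prop)
    (by fun_prop : Measurable _).aestronglyMeasurable]
  conv_lhs => rw [← hμ w.arg]
  rw [integral_map (by fun_prop) (by fun_prop : Measurable _).aestronglyMeasurable]
  refine integral_congr_ae (Filter.Eventually.of_forall fun z => ?_)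
  have hw : w = ‖w‖ * Complex.exp (w.arg * Complex.I) :=
    (Complex.norm_mul_exp_arg_mul_I w).symm
  have this : inner ℝ (Complex.exp (w.arg * Complex.I) * z) w = ‖w‖ * z.re := by
    generalize w.arg = θ at hw ⊢
    have h1 : ‖Complex.exp (θ * Complex.I)‖ = 1 := Complex.norm_exp_ofReal_mul_I _
    have h2 : (starRingEnd ℂ) (Complex.exp (θ * Complex.I)) * Complex.exp (θ * Complex.I) = 1 := by
      rw [mul_comm, Complex.mul_conj, Complex.normSq_eq_norm_sq, h1]; simp
    rw [Complex.inner, map_mul]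
    generalize ‖w‖ = r at hw ⊢
    have h3 : w * ((starRingEnd ℂ) (Complex.exp (θ * Complex.I)) * (starRingEnd ℂ) z) =
        r * (starRingEnd ℂ) z := by
      rw [hw]
      linear_combination ((r : ℂ) * (starRingEnd ℂ) z) * h2
    rw [h3]
    simp
  simp only [this]
  push_cast
  rfl

lemma IsRotationInvariant.ext {μ ν : Measure ℂ} [IsFiniteMeasure μ] [IsFiniteMeasure ν]
    (hμ : IsRotationInvariant μ) (hν : IsRotationInvariant ν)
    (h : μ.map Complex.re = ν.map Complex.re) : μ = ν :=
  Measure.ext_of_charFun <| funext fun w => by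
    rw [charFun_of_isRotationInvariant hμ, charFun_of_isRotationInvariant hν, h]

lemma measurePreserving_rotation (θ : ℝ) :
    MeasurePreserving (fun z : ℂ => Complex.exp (θ * Complex.I) * z) := by
  have h := (rotation (Circle.exp θ)).measurePreserving
  exact h

lemma isRotationInvariant_withDensity {f : ℂ → ENNReal} (hf : Measurable f)
    (hr : ∀ (θ : ℝ) (z : ℂ), f (Complex.exp (θ * Complex.I) * z) = f z) :
    IsRotationInvariant (volume.withDensity f) := by
  intro θ
  ext s hs
  have hm : Measurable (fun z : ℂ => Complex.exp (θ * Complex.I) * z) := by fun_prop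
  rw [Measure.map_apply hm hs, withDensity_apply _ (hm hs), withDensity_apply _ hs,
    ← (measurePreserving_rotation θ).setLIntegral_comp_preimage hs hf]
  simp_rw [hr]

lemma IsRotationInvariant.add {μ ν : Measure ℂ}
    (hμ : IsRotationInvariant μ) (hν : IsRotationInvariant ν) : IsRotationInvariant (μ + ν) :=
  fun θ => by rw [Measure.map_add _ _ (by fun_prop), hμ θ, hν θ]

lemma integral_withDensity_ofReal {g φ : ℂ → ℝ} (hg : Measurable g) :
    ∫ z, φ z ∂(volume.withDensity fun z => ENNReal.ofReal (g z)) = ∫ z, max (g z) 0 * φ z := by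
  rw [show (fun z => ENNReal.ofReal (g z)) = fun z => ((g z).toNNReal : ENNReal) from rfl,
    integral_withDensity_eq_integral_smul hg.real_toNNReal]
  rfl

/-- A rotation invariant measure, whose projection to the real axis has the
moments predicted by a radial signed density, has that density. -/
lemma hasPlanarDensity_of_re_moments {P : Measure ℂ} [IsFiniteMeasure P] {f : ℂ → ℝ}
    (hP : IsRotationInvariant P) (hPb : ∀ᵐ z ∂P, |z.re| ≤ 1) (hf : Measurable f)
    (hfi : Integrable f) (hfr : ∀ (θ : ℝ) (z : ℂ), f (Complex.exp (θ * Complex.I) * z) = f z)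
    (hfb : ∀ z, 1 < ‖z‖ → f z = 0)
    (hm : ∀ n : ℕ, ∫ z, z.re ^ n ∂P = ∫ z, f z * z.re ^ n) : HasPlanarDensity P f := by
  set νp := volume.withDensity fun z => ENNReal.ofReal (f z) with hνp
  set νm := volume.withDensity fun z => ENNReal.ofReal (-f z) with hνm
  have : IsFiniteMeasure νp := isFiniteMeasure_withDensity_ofReal hfi.2
  have : IsFiniteMeasure νm := isFiniteMeasure_withDensity_ofReal hfi.neg.2
  have hrp : IsRotationInvariant νp :=
    isRotationInvariant_withDensity (by fun_prop) (fun θ z => by rw [hfr])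
  have hrm : IsRotationInvariant νm :=
    isRotationInvariant_withDensity (by fun_prop) (fun θ z => by rw [hfr])
  have hbp : ∀ᵐ z ∂νp, |z.re| ≤ 1 := by
    rw [hνp, ae_withDensity_iff (by fun_prop)]
    refine Filter.Eventually.of_forall fun z hz => ?_
    by_contra h
    exact hz (by simp [hfb z ((not_le.1 h).trans_le (Complex.abs_re_le_norm z))])
  have hbm : ∀ᵐ z ∂νm, |z.re| ≤ 1 := by
    rw [hνm, ae_withDensity_iff (by fun_prop)]
    refine Filter.Eventually.of_forall fun z hz => ?_
    by_contra h
    exact hz (by simp [hfb z ((not_le.1 h).trans_le (Complex.abs_re_le_norm z))])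
  have hint : ∀ (n : ℕ) (ρ : Measure ℂ) [IsFiniteMeasure ρ], (∀ᵐ z ∂ρ, |z.re| ≤ 1) →
      Integrable (fun z => z.re ^ n) ρ := fun n ρ _ h =>
    Integrable.of_bound (C := 1) (by fun_prop : Measurable _).aestronglyMeasurable (by
      filter_upwards [h] with z hz
      rw [norm_pow]
      exact pow_le_one₀ (norm_nonneg _) hz)
  have hre : ∀ {ρ : Measure ℂ}, (∀ᵐ z ∂ρ, |z.re| ≤ 1) → ∀ᵐ x ∂(ρ.map Complex.re), |x| ≤ 1 := by
    intro ρ h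
    rw [ae_map_iff (by fun_prop) (measurableSet_le (by fun_prop) (by fun_prop))]
    exact h
  -- Adding the negative part to `P` avoids signed measures: both sides are now finite positive
  -- rotation invariant measures, to be compared through real moments.
  have key : P + νm = νp := by
    refine (hP.add hrm).ext hrp (ext_of_moments (R := 1) (hre ?_) (hre hbp) fun n => ?_)
    · rw [ae_add_measure_iff]; exact ⟨hPb, hbm⟩
    · have hI : ∀ g : ℂ → ℝ, Measurable g → Integrable g → (∀ z, 1 < ‖z‖ → g z = 0) →
          Integrable fun z => max (g z) 0 * z.re ^ n := by
        intro g hgm hg hgb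
        refine hg.mono (by fun_prop : Measurable _).aestronglyMeasurable
          (Filter.Eventually.of_forall fun z => ?_)
        rcases le_or_gt ‖z‖ 1 with hz | hz
        · rw [norm_mul, norm_pow]
          refine mul_le_of_le_one_right (norm_nonneg _)
            (pow_le_one₀ (norm_nonneg _) ((Complex.abs_re_le_norm z).trans hz)) |>.trans ?_
          rw [Real.norm_eq_abs, Real.norm_eq_abs, abs_of_nonneg (le_max_right _ _)]
          exact max_le (le_abs_self _) (abs_nonneg _)
        · simp [hgb z hz]
      rw [integral_map (by fun_prop) (by fun_prop : Measurable _).aestronglyMeasurable,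
        integral_map (by fun_prop) (by fun_prop : Measurable _).aestronglyMeasurable,
        integral_add_measure (hint n P hPb) (hint n νm hbm), hm n, hνp, hνm,
        integral_withDensity_ofReal hf, integral_withDensity_ofReal (by fun_prop),
        ← eq_sub_iff_add_eq, ← integral_sub (hI f hf hfi hfb)
          (hI (fun z => -f z) (by fun_prop) hfi.neg (fun z hz => by simp [hfb z hz]))]
      refine integral_congr_ae (Filter.Eventually.of_forall fun z => ?_)
      simp only
      rw [← sub_mul]
      congr 1
      rcases le_total (f z) 0 with h | h
      · rw [max_eq_right h, max_eq_left (by linarith)]; ring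
      · rw [max_eq_left h, max_eq_right (by linarith)]; ring
  -- `νp` does not charge the set where `f < 0`. Since `νm ≤ P + νm = νp`, neither does `νm`, whose
  -- density is positive there; so this set is Lebesgue null.
  have hS : MeasurableSet {z | f z < 0} := measurableSet_lt hf measurable_const
  have h0 : νp {z | f z < 0} = 0 := by
    rw [hνp, withDensity_apply _ hS]
    rw [setLIntegral_congr_fun (g := 0) hS]
    · simp
    · intro z hz; exact ENNReal.ofReal_of_nonpos (le_of_lt hz)
  have h1 : νm {z | f z < 0} = 0 := by
    rw [← key] at h0
    exact (add_eq_zero.1 (by simpa using h0)).2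
  have h2 : volume {z | f z < 0} = 0 := by
    rw [hνm, withDensity_apply _ hS, setLIntegral_eq_zero_iff hS (by fun_prop)] at h1
    rw [← nonpos_iff_eq_zero, ← ae_iff.1 h1]
    refine measure_mono fun z hz => ?_
    have hz' : f z < 0 := hz
    simp [hz']
  have h3 : ∀ᵐ z, 0 ≤ f z := by
    rw [ae_iff]; simpa using h2
  refine ⟨hfi, h3, ?_⟩
  have : νm = 0 := by
    rw [hνm, withDensity_eq_zero_iff (by fun_prop)]
    filter_upwards [h3] with z hz
    simpa using hz
  rw [← hνp, ← key, this, add_zero]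

/-- Two integrable densities on `[0, 1]` with the same moments agree almost everywhere. -/
lemma ae_eq_of_moments {f g : ℝ → ℝ} (hf : IntegrableOn f (Set.Icc 0 1))
    (hg : IntegrableOn g (Set.Icc 0 1))
    (hf0 : ∀ᵐ x ∂(volume.restrict (Set.Icc (0 : ℝ) 1)), 0 ≤ f x)
    (hg0 : ∀ᵐ x ∂(volume.restrict (Set.Icc (0 : ℝ) 1)), 0 ≤ g x)
    (h : ∀ n : ℕ, ∫ x in Set.Icc (0 : ℝ) 1, x ^ n * f x = ∫ x in Set.Icc (0 : ℝ) 1, x ^ n * g x) :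
    ∀ᵐ x ∂(volume.restrict (Set.Icc (0 : ℝ) 1)), f x = g x := by
  set ρ := volume.restrict (Set.Icc (0 : ℝ) 1) with hρ
  have hb : ∀ (k : ℝ → ℝ), ∀ᵐ x ∂ρ.withDensity (fun x => ENNReal.ofReal (k x)), |x| ≤ 1 := by
    intro k
    refine (withDensity_absolutelyContinuous ρ _).ae_le ?_
    filter_upwards [ae_restrict_mem measurableSet_Icc] with x hx
    rw [abs_le]; constructor <;> linarith [hx.1, hx.2]
  have hi : ∀ (k : ℝ → ℝ), IntegrableOn k (Set.Icc 0 1) → (∀ᵐ x ∂ρ, 0 ≤ k x) → ∀ n : ℕ,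
      ∫ x, x ^ n ∂(ρ.withDensity fun x => ENNReal.ofReal (k x)) = ∫ x, x ^ n * k x ∂ρ := by
    intro k hk hk0 n
    rw [show (fun z => ENNReal.ofReal (k z)) = fun z => ((k z).toNNReal : ENNReal) from rfl,
      integral_withDensity_eq_integral_smul₀ hk.aemeasurable.real_toNNReal]
    refine integral_congr_ae ?_
    filter_upwards [hk0] with x hx
    rw [NNReal.smul_def, Real.coe_toNNReal _ hx, smul_eq_mul, mul_comm]
  have hfin : IsFiniteMeasure (ρ.withDensity fun x => ENNReal.ofReal (f x)) :=
    isFiniteMeasure_withDensity_ofReal hf.2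
  have hfin : IsFiniteMeasure (ρ.withDensity fun x => ENNReal.ofReal (g x)) :=
    isFiniteMeasure_withDensity_ofReal hg.2
  have key := ext_of_moments (hb f) (hb g) fun n => by rw [hi f hf hf0, hi g hg hg0, h]
  have := (withDensity_eq_iff hf.aemeasurable.ennreal_ofReal hg.aemeasurable.ennreal_ofReal
    hf.lintegral_lt_top.ne).1 key
  filter_upwards [this, hf0, hg0] with x hx h1 h2
  exact (ENNReal.ofReal_eq_ofReal_iff h1 h2).1 hx

/-! ### Beta integrals and the moments of `F_N` -/

lemma lintegral_beta {a b : ℝ} (ha : 0 < a) (hb : 0 < b) :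
    ∫⁻ x in Set.Ioo (0 : ℝ) 1, ENNReal.ofReal (x ^ (a - 1) * (1 - x) ^ (b - 1)) =
      ENNReal.ofReal (ProbabilityTheory.beta a b) := by
  have h := ProbabilityTheory.lintegral_betaPDF_eq_one ha hb
  have hB := ProbabilityTheory.beta_pos ha hb
  rw [ProbabilityTheory.lintegral_betaPDF] at h
  simp_rw [mul_assoc, ENNReal.ofReal_mul (one_div_pos.2 hB).le] at h
  rw [lintegral_const_mul _ (by fun_prop)] at h
  generalize ∫⁻ x in Set.Ioo (0 : ℝ) 1, ENNReal.ofReal (x ^ (a - 1) * (1 - x) ^ (b - 1)) = T at h ⊢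
  calc T = ENNReal.ofReal (ProbabilityTheory.beta a b * (1 / ProbabilityTheory.beta a b)) * T := by
        rw [mul_one_div_cancel hB.ne', ENNReal.ofReal_one, one_mul]
    _ = _ := by rw [ENNReal.ofReal_mul hB.le, mul_assoc, h, mul_one]

lemma Gamma_add_natCast {a : ℝ} (ha : 0 < a) (n : ℕ) :
    Real.Gamma (a + n) = (ascPochhammer ℝ n).eval a * Real.Gamma a := by
  induction n with
  | zero => simp
  | succ n ih =>
    have : a + n ≠ 0 := by positivity
    rw [Nat.cast_succ, ← add_assoc, Real.Gamma_add_one this, ih, ascPochhammer_succ_eval]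
    ring

lemma lintegral_pow_mul_betaDensity {b : ℝ} (hb : 0 < b) (m : ℕ) :
    ∫⁻ x in Set.Ioo (0 : ℝ) 1, ENNReal.ofReal (x ^ m * betaDensity b x) =
      ENNReal.ofReal (m.factorial / (ascPochhammer ℝ m).eval (b + 1)) := by
  have h := lintegral_beta (a := m + 1) (b := b) (by positivity) hb
  have hG : 0 < Real.Gamma (b + 1) := Real.Gamma_pos_of_pos (by linarith)
  have hA : 0 < (ascPochhammer ℝ m).eval (b + 1) := ascPochhammer_pos m _ (by linarith)
  have : m.factorial / (ascPochhammer ℝ m).eval (b + 1) = b * ProbabilityTheory.beta (m + 1) b := by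
    rw [ProbabilityTheory.beta, Real.Gamma_nat_eq_factorial,
      show (m : ℝ) + 1 + b = (b + 1) + m by ring, Gamma_add_natCast (by linarith),
      Real.Gamma_add_one hb.ne']
    rw [Real.Gamma_add_one hb.ne'] at hG
    field_simp
  rw [this, ENNReal.ofReal_mul hb.le, ← h, ← lintegral_const_mul _ (by fun_prop)]
  refine lintegral_congr fun x => ?_
  rw [← ENNReal.ofReal_mul hb.le, betaDensity, add_sub_cancel_right, Real.rpow_natCast]
  ring_nf

lemma betaDensity_nonneg {b x : ℝ} (hb : 0 ≤ b) (hx : x ≤ 1) : 0 ≤ betaDensity b x :=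
  mul_nonneg hb (Real.rpow_nonneg (by linarith) _)

@[fun_prop]
lemma measurable_betaDensity (b : ℝ) : Measurable (betaDensity b) := by
  unfold betaDensity; fun_prop

/-- The multiplicative convolution of two beta densities, as a Lebesgue integral. -/
noncomputable def lmulConv (a b x : ℝ) : ENNReal :=
  ∫⁻ s in Set.Ioo (0 : ℝ) 1, (Set.Ioi x).indicator
    (fun s => ENNReal.ofReal (betaDensity a s * betaDensity b (x / s) / s)) s

lemma lmulConv_eq {a b x : ℝ} (hx : 0 < x) : lmulConv a b x =
    ∫⁻ s in Set.Ioo x 1, ENNReal.ofReal (betaDensity a s * betaDensity b (x / s) / s) := by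
  rw [lmulConv, setLIntegral_indicator measurableSet_Ioi]
  have : Set.Ioi x ∩ Set.Ioo 0 1 = Set.Ioo x 1 := by
    ext s
    simp only [Set.mem_inter_iff, Set.mem_Ioi, Set.mem_Ioo]
    exact ⟨fun h => ⟨h.1, h.2.2⟩, fun h => ⟨h.1, hx.trans h.1, h.2⟩⟩
  rw [this]

lemma measurable_lmulConv (a b : ℝ) : Measurable (lmulConv a b) := by
  unfold lmulConv
  have : Measurable fun p : ℝ × ℝ => (Set.Ioi p.1).indicator
      (fun s => ENNReal.ofReal (betaDensity a s * betaDensity b (p.1 / s) / s)) p.2 := by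
    have h : Measurable fun p : ℝ × ℝ =>
        ENNReal.ofReal (betaDensity a p.2 * betaDensity b (p.1 / p.2) / p.2) := by fun_prop
    exact h.indicator (s := {p : ℝ × ℝ | p.1 < p.2})
      (measurableSet_lt measurable_fst measurable_snd)
  exact this.lintegral_prod_right'

lemma mulConv_eq_toReal {a b x : ℝ} (ha : 0 < a) (hb : 0 < b) (hx0 : 0 < x) (hx1 : x < 1) :
    mulConv (betaDensity a) (betaDensity b) x = (lmulConv a b x).toReal := by
  rw [mulConv, intervalIntegral.integral_of_le hx1.le, integral_Ioc_eq_integral_Ioo,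
    lmulConv_eq hx0, integral_eq_lintegral_of_nonneg_ae]
  · filter_upwards [ae_restrict_mem measurableSet_Ioo] with s hs
    have hs0 : 0 < s := hx0.trans hs.1
    exact div_nonneg (mul_nonneg (betaDensity_nonneg ha.le hs.2.le)
      (betaDensity_nonneg hb.le ((div_le_one hs0).2 hs.1.le))) hs0.le
  · exact (by fun_prop : Measurable _).aestronglyMeasurable

lemma lintegral_Ioo_scale {s : ℝ} (hs : 0 < s) (f : ℝ → ENNReal) :
    ∫⁻ x in Set.Ioo 0 s, f x = ∫⁻ y in Set.Ioo (0 : ℝ) 1, ENNReal.ofReal s * f (s * y) := by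
  have h := lintegral_image_eq_lintegral_abs_deriv_mul (s := Set.Ioo (0 : ℝ) 1)
    (f := fun y => s * y) (f' := fun _ => s) measurableSet_Ioo
    (fun y _ => by simpa using ((hasDerivAt_id y).const_mul s).hasDerivWithinAt)
    (mul_right_injective₀ hs.ne').injOn f
  rw [Set.image_mul_left_Ioo hs, mul_zero, mul_one, abs_of_pos hs] at h
  exact h

lemma lintegral_pow_mul_lmulConv {a b : ℝ} (ha : 0 < a) (hb : 0 < b) (m : ℕ) :
    ∫⁻ x in Set.Ioo (0 : ℝ) 1, ENNReal.ofReal (x ^ m) * lmulConv a b x =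
      ENNReal.ofReal (m.factorial / (ascPochhammer ℝ m).eval (a + 1) *
        (m.factorial / (ascPochhammer ℝ m).eval (b + 1))) := by
  have hA : 0 < (ascPochhammer ℝ m).eval (a + 1) := ascPochhammer_pos m _ (by linarith)
  have hmeas : Measurable fun p : ℝ × ℝ => ENNReal.ofReal (p.1 ^ m) * (Set.Ioi p.1).indicator
      (fun s => ENNReal.ofReal (betaDensity a s * betaDensity b (p.1 / s) / s)) p.2 := by
    have h : Measurable fun p : ℝ × ℝ =>
        ENNReal.ofReal (betaDensity a p.2 * betaDensity b (p.1 / p.2) / p.2) := by fun_prop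
    exact (by fun_prop : Measurable fun p : ℝ × ℝ => ENNReal.ofReal (p.1 ^ m)).mul
      (h.indicator (s := {p : ℝ × ℝ | p.1 < p.2}) (measurableSet_lt measurable_fst measurable_snd))
  calc ∫⁻ x in Set.Ioo (0 : ℝ) 1, ENNReal.ofReal (x ^ m) * lmulConv a b x
      = ∫⁻ x in Set.Ioo (0 : ℝ) 1, ∫⁻ s in Set.Ioo (0 : ℝ) 1, ENNReal.ofReal (x ^ m) *
          (Set.Ioi x).indicator
            (fun s => ENNReal.ofReal (betaDensity a s * betaDensity b (x / s) / s)) s := by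
        refine lintegral_congr fun x => ?_
        rw [lmulConv, lintegral_const_mul' _ _ ENNReal.ofReal_ne_top]
    _ = ∫⁻ s in Set.Ioo (0 : ℝ) 1, ∫⁻ x in Set.Ioo (0 : ℝ) 1, ENNReal.ofReal (x ^ m) *
          (Set.Ioi x).indicator
            (fun s => ENNReal.ofReal (betaDensity a s * betaDensity b (x / s) / s)) s :=
        lintegral_lintegral_swap hmeas.aemeasurable
    _ = ∫⁻ s in Set.Ioo (0 : ℝ) 1, ENNReal.ofReal (s ^ m * betaDensity a s) *
          ENNReal.ofReal (m.factorial / (ascPochhammer ℝ m).eval (b + 1)) := by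
        refine setLIntegral_congr_fun measurableSet_Ioo fun s hs => ?_
        have hs0 : 0 < s := hs.1
        have h1 : ∫⁻ x in Set.Ioo (0 : ℝ) 1, ENNReal.ofReal (x ^ m) * (Set.Ioi x).indicator
            (fun s => ENNReal.ofReal (betaDensity a s * betaDensity b (x / s) / s)) s =
            ∫⁻ x in Set.Ioo (0 : ℝ) s, ENNReal.ofReal (x ^ m) *
              ENNReal.ofReal (betaDensity a s * betaDensity b (x / s) / s) := by
          have : Set.Ioo 0 s = Set.Iio s ∩ Set.Ioo (0 : ℝ) 1 := by
            ext x
            simp only [Set.mem_inter_iff, Set.mem_Iio, Set.mem_Ioo]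
            constructor
            · rintro ⟨h1, h2⟩; exact ⟨h2, h1, h2.trans hs.2⟩
            · rintro ⟨h1, h2, h3⟩; exact ⟨h2, h1⟩
          rw [this, ← setLIntegral_indicator measurableSet_Iio]
          refine lintegral_congr fun x => ?_
          by_cases hx : x < s
          · simp [Set.indicator, hx]
          · simp [Set.indicator, hx]
        -- Substitute `x = s y`: the Jacobian cancels the `1/s` of the convolution and `x^m = s^m
        -- y^m` separates the two moments.
        rw [h1, lintegral_Ioo_scale hs0, ← lintegral_pow_mul_betaDensity hb,
          ← lintegral_const_mul' _ _ ENNReal.ofReal_ne_top]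
        refine setLIntegral_congr_fun measurableSet_Ioo fun y hy => ?_
        have hbs := betaDensity_nonneg ha.le hs.2.le
        have hby := betaDensity_nonneg hb.le hy.2.le
        have hy0 := hy.1.le
        rw [← ENNReal.ofReal_mul (by positivity), ← ENNReal.ofReal_mul (by positivity),
          ← ENNReal.ofReal_mul (by positivity), mul_div_cancel_left₀ _ hs0.ne']
        congr 1
        field_simp
        rw [mul_pow]
        ring
    _ = _ := by
        rw [lintegral_mul_const' _ _ ENNReal.ofReal_ne_top, lintegral_pow_mul_betaDensity ha,
          ENNReal.ofReal_mul (by positivity)]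

lemma F_two {x : ℝ} (h0 : 0 < x) (h1 : x < 1) : F 2 x = betaDensity (1 / 2) x := by
  simp [F, h0, h1]

lemma F_of_three_le {N : ℕ} (hN : 3 ≤ N) {x : ℝ} (h0 : 0 < x) (h1 : x < 1) :
    F N x = (lmulConv (((N : ℝ) - 1) / 2) (((N : ℝ) - 2) / 2) x).toReal := by
  have : (3 : ℝ) ≤ N := by exact_mod_cast hN
  rw [F, if_pos ⟨h0, h1⟩, if_neg (by omega), mulConv_eq_toReal (by linarith) (by linarith) h0 h1]

lemma F_eq_zero {N : ℕ} {x : ℝ} (h : ¬ (0 < x ∧ x < 1)) : F N x = 0 := if_neg h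

lemma F_nonneg {N : ℕ} (hN : 2 ≤ N) (x : ℝ) : 0 ≤ F N x := by
  by_cases h : 0 < x ∧ x < 1
  · rcases hN.eq_or_lt with rfl | hN
    · rw [F_two h.1 h.2]; exact betaDensity_nonneg (by norm_num) h.2.le
    · rw [F_of_three_le hN h.1 h.2]; exact ENNReal.toReal_nonneg
  · rw [F_eq_zero h]

lemma measurable_F {N : ℕ} (hN : 2 ≤ N) : Measurable (F N) := by
  rcases hN.eq_or_lt with rfl | hN
  · have : F 2 = (Set.Ioo 0 1).indicator (betaDensity (1 / 2)) := by
      ext x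
      by_cases h : 0 < x ∧ x < 1
      · rw [F_two h.1 h.2, Set.indicator_of_mem (show x ∈ Set.Ioo 0 1 from h)]
      · rw [F_eq_zero h, Set.indicator_of_notMem (show x ∉ Set.Ioo 0 1 from h)]
    rw [this]
    exact (measurable_betaDensity _).indicator measurableSet_Ioo
  · have : F N = (Set.Ioo 0 1).indicator
        (fun x => (lmulConv (((N : ℝ) - 1) / 2) (((N : ℝ) - 2) / 2) x).toReal) := by
      ext x
      by_cases h : 0 < x ∧ x < 1
      · rw [F_of_three_le hN h.1 h.2, Set.indicator_of_mem (show x ∈ Set.Ioo 0 1 from h)]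
      · rw [F_eq_zero h, Set.indicator_of_notMem (show x ∉ Set.Ioo 0 1 from h)]
    rw [this]
    exact (measurable_lmulConv _ _).ennreal_toReal.indicator measurableSet_Ioo

/-- The `m`-th moment of `F N`. -/
noncomputable def shadowMoment (N m : ℕ) : ℝ := (m.factorial : ℝ) ^ 2 /
      ((ascPochhammer ℝ m).eval ((N : ℝ) / 2) * (ascPochhammer ℝ m).eval (((N : ℝ) + 1) / 2))

lemma lintegral_pow_mul_F {N : ℕ} (hN : 2 ≤ N) (m : ℕ) :
    ∫⁻ x in Set.Ioo (0 : ℝ) 1, ENNReal.ofReal (x ^ m * F N x) =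
      ENNReal.ofReal (shadowMoment N m) := by
  rcases hN.eq_or_lt with rfl | hN
  -- For `N = 2` the factor `(N/2)_m = (1)_m = m!` cancels one factorial, leaving the moment of a
  -- single beta density.
  · have h1 : shadowMoment 2 m = m.factorial / (ascPochhammer ℝ m).eval ((1 : ℝ) / 2 + 1) := by
      have h2 : (ascPochhammer ℝ m).eval (1 : ℝ) = m.factorial := by
        have := ascPochhammer_eval_one ℝ m
        exact this
      have h3 : ((2 : ℕ) : ℝ) / 2 = 1 := by norm_num
      have h4 : (((2 : ℕ) : ℝ) + 1) / 2 = 1 / 2 + 1 := by norm_num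
      have h5 : (0 : ℝ) < (ascPochhammer ℝ m).eval ((1 : ℝ) / 2 + 1) :=
        ascPochhammer_pos m _ (by norm_num)
      rw [shadowMoment, h3, h4, h2]
      field_simp
    rw [h1, ← lintegral_pow_mul_betaDensity (by norm_num)]
    exact setLIntegral_congr_fun measurableSet_Ioo fun x hx => by
      rw [F_two hx.1 hx.2]
  · have hN' : (3 : ℝ) ≤ N := by exact_mod_cast hN
    set a := ((N : ℝ) - 1) / 2 with ha
    set b := ((N : ℝ) - 2) / 2 with hb
    have ha0 : 0 < a := by linarith
    have hb0 : 0 < b := by linarith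
    have h1 : shadowMoment N m = m.factorial / (ascPochhammer ℝ m).eval (a + 1) *
        (m.factorial / (ascPochhammer ℝ m).eval (b + 1)) := by
      have h3 : (N : ℝ) / 2 = b + 1 := by rw [hb]; ring
      have h4 : ((N : ℝ) + 1) / 2 = a + 1 := by rw [ha]; ring
      rw [shadowMoment, h3, h4, div_mul_div_comm]
      ring
    rw [h1, ← lintegral_pow_mul_lmulConv ha0 hb0]
    -- `F` passes through `toReal`, which sends `⊤` to `0`; finiteness of the zeroth moment makes
    -- this harmless almost everywhere.
    have hfin : ∀ᵐ x ∂(volume.restrict (Set.Ioo (0 : ℝ) 1)), lmulConv a b x < ⊤ := by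
      refine ae_lt_top (measurable_lmulConv a b) ?_
      have := lintegral_pow_mul_lmulConv ha0 hb0 0
      simp only [pow_zero, ENNReal.ofReal_one, one_mul] at this
      rw [this]
      exact ENNReal.ofReal_ne_top
    refine lintegral_congr_ae ?_
    filter_upwards [hfin, ae_restrict_mem measurableSet_Ioo] with x hx hx1
    rw [F_of_three_le hN hx1.1 hx1.2, ENNReal.ofReal_mul (pow_nonneg hx1.1.le _),
      ENNReal.ofReal_toReal hx.ne]

lemma shadowMoment_nonneg {N : ℕ} (hN : 2 ≤ N) (m : ℕ) : 0 ≤ shadowMoment N m := by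
  have hN' : (2 : ℝ) ≤ N := by exact_mod_cast hN
  have := ascPochhammer_pos m ((N : ℝ) / 2) (by linarith)
  have := ascPochhammer_pos m (((N : ℝ) + 1) / 2) (by linarith)
  unfold shadowMoment
  positivity

lemma integrableOn_pow_mul_F {N : ℕ} (hN : 2 ≤ N) (m : ℕ) :
    IntegrableOn (fun x => x ^ m * F N x) (Set.Ioo 0 1) := by
  have := measurable_F hN
  refine ⟨(by fun_prop : Measurable _).aestronglyMeasurable, ?_⟩
  rw [hasFiniteIntegral_iff_ofReal, lintegral_pow_mul_F hN]
  · exact ENNReal.ofReal_lt_top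
  · filter_upwards [ae_restrict_mem measurableSet_Ioo] with x hx
    exact mul_nonneg (pow_nonneg hx.1.le _) (F_nonneg hN x)

lemma integral_pow_mul_F {N : ℕ} (hN : 2 ≤ N) (m : ℕ) :
    ∫ x in Set.Ioo (0 : ℝ) 1, x ^ m * F N x = shadowMoment N m := by
  rw [integral_eq_lintegral_of_nonneg_ae _ (integrableOn_pow_mul_F hN m).1,
    lintegral_pow_mul_F hN, ENNReal.toReal_ofReal (shadowMoment_nonneg hN m)]
  filter_upwards [ae_restrict_mem measurableSet_Ioo] with x hx
  exact mul_nonneg (pow_nonneg hx.1.le _) (F_nonneg hN x)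

lemma hasShadowMoments_F {N : ℕ} (hN : 2 ≤ N) : HasShadowMoments N (F N) := fun m => by
  rw [integral_Icc_eq_integral_Ioo, integral_pow_mul_F hN]
  rfl

lemma isUnitIntervalDensity_F {N : ℕ} (hN : 2 ≤ N) : IsUnitIntervalDensity (F N) := by
  refine ⟨?_, Filter.Eventually.of_forall (F_nonneg hN), ?_⟩
  · rw [integrableOn_Icc_iff_integrableOn_Ioo]
    simpa using integrableOn_pow_mul_F hN 0
  · have := hasShadowMoments_F hN 0
    simpa using this

/-! ### Binomial series and the hypergeometric form -/

lemma hasSum_one_sub_rpow_neg (b : ℝ) {x : ℝ} (h1 : |x| < 1) :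
    HasSum (fun n : ℕ => (ascPochhammer ℝ n).eval b / n.factorial * x ^ n) ((1 - x) ^ (-b)) := by
  have h := (Real.one_div_one_sub_rpow_hasFPowerSeriesOnBall_zero b).hasSum (y := x) (by
    rw [Metric.mem_eball, edist_zero_right, Real.enorm_eq_ofReal_abs]
    exact_mod_cast (ENNReal.ofReal_lt_one.2 h1))
  have h0 := le_abs_self x
  simp only [FormalMultilinearSeries.ofScalars_apply_eq, zero_add, smul_eq_mul] at h
  rw [one_div, ← Real.rpow_neg (by linarith)] at h
  refine h.congr_fun fun n => ?_
  have h2 : (n.factorial : ℝ) * Ring.choose (b + n - 1) n = (ascPochhammer ℝ n).eval b := by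
    have h3 := Ring.factorial_nsmul_multichoose_eq_ascPochhammer b n
    rw [Polynomial.ascPochhammer_smeval_eq_eval] at h3
    rw [← h3, nsmul_eq_mul, Ring.choose, show b + n - 1 - n + 1 = b by ring]
  rw [← h2, mul_div_cancel_left₀ _ (by positivity)]

lemma beta_add_natCast {a b : ℝ} (ha : 0 < a) (hb : 0 < b) (n : ℕ) :
    ProbabilityTheory.beta (a + n) b = ProbabilityTheory.beta a b *
      ((ascPochhammer ℝ n).eval a * ((ascPochhammer ℝ n).eval (a + b))⁻¹) := by
  rw [ProbabilityTheory.beta, ProbabilityTheory.beta, Gamma_add_natCast ha,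
    show a + n + b = (a + b) + n by ring, Gamma_add_natCast (by linarith)]
  ring

/-- The substitution `s = 1 - z t` produces the Euler kernel, because `1 - (1-z)/s = z(1-t)/(1-zt)`.
-/
lemma lmulConv_one_sub {a b z : ℝ} (ha : 0 < a) (hb : 0 < b) (hz0 : 0 < z) (hz1 : z < 1) :
    lmulConv a b (1 - z) = ∫⁻ t in Set.Ioo (0 : ℝ) 1, ENNReal.ofReal
      (a * b * z ^ (a + b - 1) * (t ^ (a - 1) * (1 - t) ^ (b - 1)) * (1 - z * t) ^ (-b)) := by
  have h := lintegral_image_eq_lintegral_abs_deriv_mul (s := Set.Ioo (0 : ℝ) 1)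
    (f := fun t => 1 - z * t) (f' := fun _ => -z) measurableSet_Ioo
    (fun y _ => by
      simpa using (((hasDerivAt_id y).const_mul z).const_sub 1).hasDerivWithinAt)
    (fun x _ y _ hxy => by
      have : 1 - z * x = 1 - z * y := hxy
      exact mul_left_cancel₀ hz0.ne' (by linarith))
    (fun s => ENNReal.ofReal (betaDensity a s * betaDensity b ((1 - z) / s) / s))
  have him : (fun t => 1 - z * t) '' Set.Ioo (0 : ℝ) 1 = Set.Ioo (1 - z) 1 := by
    rw [show (fun t => 1 - z * t) = (fun t => 1 - t) ∘ (fun t => z * t) from rfl, Set.image_comp,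
      Set.image_mul_left_Ioo hz0, Set.image_const_sub_Ioo]
    simp
  rw [him] at h
  rw [lmulConv_eq (by linarith), h, abs_neg, abs_of_pos hz0]
  refine setLIntegral_congr_fun measurableSet_Ioo fun t ht => ?_
  have ht0 := ht.1
  have ht1 : 0 < 1 - t := sub_pos.2 ht.2
  have hzt : 0 < 1 - z * t := by nlinarith
  rw [← ENNReal.ofReal_mul hz0.le]
  congr 1
  rw [betaDensity, betaDensity, show 1 - (1 - z * t) = z * t by ring,
    show 1 - (1 - z) / (1 - z * t) = z * (1 - t) / (1 - z * t) by field_simp; ring,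
    Real.mul_rpow hz0.le ht0.le, Real.div_rpow (by positivity) hzt.le,
    Real.mul_rpow hz0.le ht1.le, show a + b - 1 = 1 + (a - 1) + (b - 1) by ring,
    Real.rpow_add hz0, Real.rpow_add hz0, Real.rpow_one, show -b = -(1 + (b - 1)) by ring,
    Real.rpow_neg hzt.le, Real.rpow_add hzt, Real.rpow_one]
  field_simp

/-- Euler's integral for the hypergeometric function. -/
lemma mulConv_betaDensity {a b x : ℝ} (ha : 0 < a) (hb : 0 < b) (hx0 : 0 < x) (hx1 : x < 1) :
    mulConv (betaDensity a) (betaDensity b) x =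
      Real.Gamma (a + 1) * Real.Gamma (b + 1) / Real.Gamma (a + b) * (1 - x) ^ (a + b - 1) *
        ordinaryHypergeometric a b (a + b) (1 - x) := by
  have hB := ProbabilityTheory.beta_pos ha hb
  obtain ⟨z, rfl⟩ : ∃ z, x = 1 - z := ⟨1 - x, by ring⟩
  have hz0 : 0 < z := by linarith
  have hz1 : z < 1 := by linarith
  have hP : ∀ {c : ℝ}, 0 < c → ∀ n, 0 < (ascPochhammer ℝ n).eval c :=
    fun hc n => ascPochhammer_pos n _ hc
  have hzr := Real.rpow_pos_of_pos hz0 (a + b - 1)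
  -- Expand `(1 - z t)^(-b)` and integrate termwise against the beta kernel. All terms are
  -- nonnegative, so the interchange in `ENNReal` needs no domination.
  have key : lmulConv a b (1 - z) = ∑' n : ℕ, ENNReal.ofReal
      (a * b * z ^ (a + b - 1) * ProbabilityTheory.beta a b *
        (((n.factorial : ℝ)⁻¹ * (ascPochhammer ℝ n).eval a * (ascPochhammer ℝ n).eval b *
          ((ascPochhammer ℝ n).eval (a + b))⁻¹) * z ^ n)) := by
    rw [lmulConv_one_sub ha hb hz0 hz1]
    calc _ = ∫⁻ t in Set.Ioo (0 : ℝ) 1, ∑' n : ℕ, ENNReal.ofReal (a * b * z ^ (a + b - 1) *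
          ((ascPochhammer ℝ n).eval b / n.factorial * z ^ n)) *
            ENNReal.ofReal (t ^ ((a + n) - 1) * (1 - t) ^ (b - 1)) := by
          refine setLIntegral_congr_fun measurableSet_Ioo fun t ht => ?_
          have ht0 := ht.1
          have ht1 : 0 < 1 - t := sub_pos.2 ht.2
          have hzt : z * t < 1 := by nlinarith
          have hs := (hasSum_one_sub_rpow_neg b ((abs_of_pos (mul_pos hz0 ht0)).trans_lt hzt)).mul_left
            (a * b * z ^ (a + b - 1) * (t ^ (a - 1) * (1 - t) ^ (b - 1)))
          rw [← hs.tsum_eq, ENNReal.ofReal_tsum_of_nonneg _ hs.summable]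
          · refine tsum_congr fun n => ?_
            have := hP hb n
            rw [← ENNReal.ofReal_mul (by positivity), add_sub_right_comm a (n : ℝ) 1, Real.rpow_add ht0,
              Real.rpow_natCast, mul_pow]
            congr 1
            ring
          · intro n
            have := hP hb n
            positivity
      _ = ∑' n : ℕ, ENNReal.ofReal (a * b * z ^ (a + b - 1) *
          ((ascPochhammer ℝ n).eval b / n.factorial * z ^ n)) *
            ENNReal.ofReal (ProbabilityTheory.beta (a + n) b) := by
          rw [lintegral_tsum fun n => by fun_prop]
          refine tsum_congr fun n => ?_
          rw [lintegral_const_mul' _ _ ENNReal.ofReal_ne_top, lintegral_beta (by positivity) hb]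
      _ = _ := by
          refine tsum_congr fun n => ?_
          have := hP hb n
          rw [← ENNReal.ofReal_mul (by positivity), beta_add_natCast ha hb]
          congr 1
          ring
  rw [mulConv_eq_toReal ha hb hx0 hx1, key, ENNReal.tsum_toReal_eq fun _ => ENNReal.ofReal_ne_top,
    sub_sub_cancel, ordinaryHypergeometric, ordinaryHypergeometric_sum_eq, ← tsum_mul_left]
  refine tsum_congr fun n => ?_
  have := hP hb n
  have := hP ha n
  have := hP (add_pos ha hb) n
  rw [ENNReal.toReal_ofReal (by positivity), Real.Gamma_add_one ha.ne', Real.Gamma_add_one hb.ne',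
    smul_eq_mul, ProbabilityTheory.beta]
  ring

lemma F_eq_hypergeometric {N : ℕ} (hN : 2 ≤ N) {x : ℝ} (h0 : 0 < x) (h1 : x < 1) :
    F N x =
        Real.Gamma ((N : ℝ) / 2) * Real.Gamma (((N : ℝ) + 1) / 2) / Real.Gamma ((N : ℝ) - 3 / 2) *
          (1 - x) ^ ((N : ℝ) - 5 / 2) *
          ordinaryHypergeometric (((N : ℝ) - 1) / 2) (((N : ℝ) - 2) / 2) ((N : ℝ) - 3 / 2)
            (1 - x) := by
  rcases hN.eq_or_lt with rfl | hN
  -- For `N = 2` the second parameter is `0`, so only the constant term of the series survives.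
  · have hF : ordinaryHypergeometric (1 / 2 : ℝ) 0 (1 / 2 : ℝ) (1 - x) = 1 := by
      rw [ordinaryHypergeometric, ordinaryHypergeometric_sum_eq, tsum_eq_single 0]
      · simp
      · intro n hn
        simp [hn]
    have h12 : Real.Gamma (3 / 2) = 1 / 2 * Real.Gamma (1 / 2) := by
      rw [← Real.Gamma_add_one (by norm_num)]; norm_num
    have hG : Real.Gamma (1 / 2) ≠ 0 := (Real.Gamma_pos_of_pos (by norm_num)).ne'
    rw [F_two h0 h1, betaDensity]
    norm_num at hF h12 hG ⊢
    rw [hF, h12]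
    field_simp
  · have hN' : (3 : ℝ) ≤ N := by exact_mod_cast hN
    rw [F, if_pos ⟨h0, h1⟩, if_neg (by omega), mulConv_betaDensity (by linarith) (by linarith) h0 h1]
    rw [show ((N : ℝ) - 1) / 2 + 1 = (N + 1) / 2 by ring,
      show ((N : ℝ) - 2) / 2 + 1 = N / 2 by ring,
      show ((N : ℝ) - 1) / 2 + (N - 2) / 2 = N - 3 / 2 by ring,
      show (N : ℝ) - 3 / 2 - 1 = N - 5 / 2 by ring, mul_comm (Real.Gamma ((N : ℝ) / 2))]

/-! ### Sphere integrals through Gaussian integrals -/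

section Polar

variable {E : Type*} [NormedAddCommGroup E] [NormedSpace ℝ E] [FiniteDimensional ℝ E]
  [Nontrivial E] [MeasurableSpace E] [BorelSpace E] (μ : Measure E) [μ.IsAddHaarMeasure]

/-- Integration in polar coordinates. -/
lemma lintegral_eq_lintegral_toSphere {g : E → ENNReal} (hg : Measurable g) :
    ∫⁻ x, g x ∂μ = ∫⁻ u : Metric.sphere (0 : E) 1, (∫⁻ r in Set.Ioi (0 : ℝ),
      ENNReal.ofReal (r ^ (Module.finrank ℝ E - 1)) * g (r • (u : E))) ∂μ.toSphere := by
  calc ∫⁻ x, g x ∂μ = ∫⁻ x : ({(0)}ᶜ : Set E), g x ∂(μ.comap (↑)) := by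
        rw [lintegral_subtype_comap (measurableSet_singleton _).compl g, restrict_compl_singleton]
    _ = ∫⁻ p, g (p.2.1 • (p.1 : E)) ∂μ.toSphere.prod (.volumeIoiPow (Module.finrank ℝ E - 1)) := by
        rw [← μ.measurePreserving_homeomorphUnitSphereProd.lintegral_comp_emb
          (Homeomorph.measurableEmbedding _)]
        refine lintegral_congr fun x => ?_
        have hx : ‖(x : E)‖ ≠ 0 := norm_ne_zero_iff.2 x.2
        simp [smul_smul, hx]
    _ = ∫⁻ u : Metric.sphere (0 : E) 1, ∫⁻ r : Set.Ioi (0 : ℝ), g (r.1 • (u : E))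
          ∂(Measure.volumeIoiPow (Module.finrank ℝ E - 1)) ∂μ.toSphere :=
        lintegral_prod _ (by fun_prop)
    _ = _ := by
        refine lintegral_congr fun u => ?_
        rw [Measure.volumeIoiPow, lintegral_withDensity_eq_lintegral_mul _ (by fun_prop)
          (by fun_prop), ← lintegral_subtype_comap measurableSet_Ioi]
        rfl

lemma lintegral_pow_mul_exp_neg_mul_sq {d : ℕ} (hd : 0 < d) {c : ℝ} (hc : 0 < c) :
    ∫⁻ r in Set.Ioi (0 : ℝ), ENNReal.ofReal (r ^ (d - 1) * Real.exp (-(r ^ 2 * c))) =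
      ENNReal.ofReal (c ^ (-(d / 2 : ℝ)) * (Real.Gamma (d / 2) / 2)) := by
  have hq : (-1 : ℝ) < (d - 1 : ℕ) := by have := Nat.cast_nonneg (α := ℝ) (d - 1); linarith
  have h := integral_rpow_mul_exp_neg_mul_rpow (p := 2) (q := (d - 1 : ℕ)) two_pos hq hc
  have hi := integrableOn_rpow_mul_exp_neg_mul_rpow (p := 2) (s := (d - 1 : ℕ)) hq two_pos hc
  have hd' : ((d - 1 : ℕ) : ℝ) + 1 = d := by
    rw [← Nat.cast_succ, Nat.succ_eq_add_one, Nat.sub_add_cancel hd]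
  have he : ∀ r : ℝ, r ^ ((d - 1 : ℕ) : ℝ) * Real.exp (-c * r ^ (2 : ℝ)) =
      r ^ (d - 1) * Real.exp (-(r ^ 2 * c)) := by
    intro r
    rw [Real.rpow_natCast, Real.rpow_two]
    congr 2
    ring
  simp_rw [he] at h hi
  rw [← ofReal_integral_eq_lintegral_ofReal hi, h, hd']
  · congr 1
    rw [neg_div]
    ring
  · filter_upwards [ae_restrict_mem measurableSet_Ioi] with r hr
    have : (0 : ℝ) < r := hr
    positivity

/-- On the ray through `u` the exponent is `r² Q(u)`, so the radial integral gives `Q(u)^(-d/2)` up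
to a constant, where `d` is the real dimension. -/
lemma lintegral_mul_exp_neg_quadratic {g : E → ENNReal} (hg : Measurable g)
    (hg0 : ∀ (r : ℝ) (x : E), 0 < r → g (r • x) = g x) {Q : E → ℝ} (hQ : Measurable Q)
    (hQ0 : ∀ (r : ℝ) (x : E), Q (r • x) = r ^ 2 * Q x) (hQp : ∀ x : E, ‖x‖ = 1 → 0 < Q x) :
    ∫⁻ x, g x * ENNReal.ofReal (Real.exp (-Q x)) ∂μ =
      ENNReal.ofReal (Real.Gamma (Module.finrank ℝ E / 2) / 2) *
        ∫⁻ u : Metric.sphere (0 : E) 1,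
          g u * ENNReal.ofReal (Q u ^ (-(Module.finrank ℝ E / 2 : ℝ))) ∂μ.toSphere := by
  have hd : 0 < Module.finrank ℝ E := Module.finrank_pos
  rw [lintegral_eq_lintegral_toSphere μ (by fun_prop), ← lintegral_const_mul _ (by fun_prop)]
  refine lintegral_congr fun u => ?_
  have hu : 0 < Q u := hQp u (by simp)
  have hG : 0 < Real.Gamma (Module.finrank ℝ E / 2) := Real.Gamma_pos_of_pos (by positivity)
  have h1 : ∫⁻ r in Set.Ioi (0 : ℝ), ENNReal.ofReal (r ^ (Module.finrank ℝ E - 1)) *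
      (g (r • (u : E)) * ENNReal.ofReal (Real.exp (-Q (r • (u : E))))) =
      ∫⁻ r in Set.Ioi (0 : ℝ), ENNReal.ofReal (r ^ (Module.finrank ℝ E - 1) *
        Real.exp (-(r ^ 2 * Q u))) * g u := by
    refine setLIntegral_congr_fun measurableSet_Ioi fun r hr => ?_
    have : (0 : ℝ) < r := hr
    rw [hg0 r _ hr, hQ0, ENNReal.ofReal_mul (by positivity)]
    ring
  rw [h1, lintegral_mul_const _ (by fun_prop), lintegral_pow_mul_exp_neg_mul_sq hd hu, mul_comm (_ ^ _),
    ENNReal.ofReal_mul (by positivity)]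
  ring

end Polar

lemma lintegral_exp_neg_mul_normSq {c : ℝ} (hc : 0 < c) :
    ∫⁻ z : ℂ, ENNReal.ofReal (Real.exp (-(c * ‖z‖ ^ 2))) = ENNReal.ofReal (Real.pi / c) := by
  have h := Complex.integral_rpow_mul_exp_neg_mul_rpow (p := 2) (q := 0) (by norm_num) (by norm_num) hc
  have he : ∀ z : ℂ, ‖z‖ ^ (0 : ℝ) * Real.exp (-c * ‖z‖ ^ (2 : ℝ)) =
      Real.exp (-(c * ‖z‖ ^ 2)) := by
    intro z; rw [Real.rpow_zero, one_mul, Real.rpow_two, neg_mul]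
  simp_rw [he] at h
  have hv : 2 * Real.pi / 2 * c ^ (-((0 : ℝ) + 2) / 2) * Real.Gamma ((0 + 2) / 2) = Real.pi / c := by
    norm_num [Real.rpow_neg_one]
    rfl
  rw [hv] at h
  have hp : 0 < Real.pi / c := by positivity
  rw [← ofReal_integral_eq_lintegral_ofReal, h]
  -- Integrability comes from the value: a non-integrable function has Bochner integral `0`, but
  -- here it is `π/c > 0`.
  · by_contra hi
    rw [integral_undef hi] at h
    exact hp.ne h
  · exact Filter.Eventually.of_forall fun z => (Real.exp_pos _).le

lemma lintegral_pi_exp_neg {N : ℕ} {c : Fin N → ℝ} (hc : ∀ i, 0 < c i) :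
    ∫⁻ z : Fin N → ℂ, ENNReal.ofReal (Real.exp (-∑ i, c i * ‖z i‖ ^ 2)) =
      ENNReal.ofReal (∏ i, (Real.pi / c i)) := by
  have h1 : ∀ i, Integrable fun z : ℂ => Real.exp (-(c i * ‖z‖ ^ 2)) := fun i => by
    refine ⟨(by fun_prop : Measurable _).aestronglyMeasurable, ?_⟩
    rw [hasFiniteIntegral_iff_ofReal (Filter.Eventually.of_forall fun z => (Real.exp_pos _).le),
      lintegral_exp_neg_mul_normSq (hc i)]
    exact ENNReal.ofReal_lt_top
  have h2 : ∀ i, ∫ z : ℂ, Real.exp (-(c i * ‖z‖ ^ 2)) = Real.pi / c i := fun i => by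
    have := hc i
    rw [integral_eq_lintegral_of_nonneg_ae (Filter.Eventually.of_forall fun z => (Real.exp_pos _).le)
      (h1 i).1, lintegral_exp_neg_mul_normSq (hc i), ENNReal.toReal_ofReal (by positivity)]
  simp_rw [← Finset.sum_neg_distrib, Real.exp_sum]
  rw [← ofReal_integral_eq_lintegral_ofReal]
  · rw [integral_fintype_prod_volume_eq_prod (fun i (z : ℂ) => Real.exp (-(c i * ‖z‖ ^ 2)))]
    simp_rw [h2]
  · exact Integrable.fintype_prod h1
  · exact Filter.Eventually.of_forall fun z => Finset.prod_nonneg fun i _ => (Real.exp_pos _).le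

/-- The Euclidean volume and the product volume are both Haar, hence proportional. The constant
stays implicit because it is fixed later by the case where all `c i` equal `1`. -/
lemma exists_lintegral_exp_neg (N : ℕ) : ∃ K : ENNReal, ∀ c : Fin N → ℝ, (∀ i, 0 < c i) →
    ∫⁻ x : EuclideanSpace ℂ (Fin N), ENNReal.ofReal (Real.exp (-∑ i, c i * ‖x i‖ ^ 2)) =
      K * ENNReal.ofReal (∏ i, (c i)⁻¹) := by
  let e : EuclideanSpace ℂ (Fin N) ≃L[ℝ] (Fin N → ℂ) := PiLp.continuousLinearEquiv 2 ℝ fun _ => ℂ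
  have : (Measure.map e volume).IsAddHaarMeasure := e.isAddHaarMeasure_map volume
  have he := Measure.isAddLeftInvariant_eq_smul (Measure.map e volume)
    (volume : Measure (Fin N → ℂ))
  set k := Measure.addHaarScalarFactor (Measure.map e volume) (volume : Measure (Fin N → ℂ))
  refine ⟨k * ENNReal.ofReal (Real.pi ^ N), fun c hc => ?_⟩
  have h1 : ∫⁻ x : EuclideanSpace ℂ (Fin N), ENNReal.ofReal (Real.exp (-∑ i, c i * ‖x i‖ ^ 2)) =
      ∫⁻ z, ENNReal.ofReal (Real.exp (-∑ i, c i * ‖z i‖ ^ 2)) ∂(Measure.map e volume) := by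
    rw [lintegral_map (by fun_prop) e.continuous.measurable]
    rfl
  rw [h1, he, lintegral_smul_measure, lintegral_pi_exp_neg hc]
  simp_rw [div_eq_mul_inv]
  rw [Finset.prod_mul_distrib, Finset.prod_const, Finset.card_univ, Fintype.card_fin,
    ENNReal.ofReal_mul (by positivity), mul_assoc]
  rfl

lemma sphereMeasure_univ {N : ℕ} (hN : 1 ≤ N) : sphereMeasure N Set.univ = 1 := by
  have : Nonempty (Fin N) := ⟨⟨0, hN⟩⟩
  rw [sphereMeasure, Measure.smul_apply, smul_eq_mul]
  exact ENNReal.inv_mul_cancel (Measure.measure_univ_ne_zero.2 (Measure.toSphere_ne_zero _))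
    (measure_ne_top _ _)

lemma finrank_real_euclideanSpace (N : ℕ) :
    Module.finrank ℝ (EuclideanSpace ℂ (Fin N)) = 2 * N := by
  rw [← Module.finrank_mul_finrank ℝ ℂ (EuclideanSpace ℂ (Fin N))]
  simp

/-- Integration of a degree `0` homogeneous function over the sphere as a Gaussian integral. -/
lemma exists_lintegral_sphereMeasure {N : ℕ} (hN : 1 ≤ N) : ∃ K : ENNReal, K ≠ 0 ∧ K ≠ ⊤ ∧
    ∀ g : EuclideanSpace ℂ (Fin N) → ENNReal, Measurable g →
    (∀ (r : ℝ) (x : EuclideanSpace ℂ (Fin N)), 0 < r → g (r • x) = g x) →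
    ∀ Q : EuclideanSpace ℂ (Fin N) → ℝ, Measurable Q →
    (∀ (r : ℝ) (x : EuclideanSpace ℂ (Fin N)), Q (r • x) = r ^ 2 * Q x) →
    (∀ x : EuclideanSpace ℂ (Fin N), ‖x‖ = 1 → 0 < Q x) →
    ∫⁻ x, g x * ENNReal.ofReal (Real.exp (-Q x)) =
      K * ∫⁻ u : UnitSphere N, g u * ENNReal.ofReal (Q u ^ (-(N : ℝ))) ∂(sphereMeasure N) := by
  have : Nonempty (Fin N) := ⟨⟨0, hN⟩⟩
  set σ := (volume : Measure (EuclideanSpace ℂ (Fin N))).toSphere with hσ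
  have h0 : σ Set.univ ≠ 0 :=
    Measure.measure_univ_ne_zero.2 (Measure.toSphere_ne_zero _)
  have h1 : σ Set.univ ≠ ⊤ := measure_ne_top _ _
  have hG : 0 < Real.Gamma N := Real.Gamma_pos_of_pos (by positivity)
  refine ⟨ENNReal.ofReal (Real.Gamma N / 2) * σ Set.univ,
    mul_ne_zero (by simpa using hG) h0, ENNReal.mul_ne_top ENNReal.ofReal_ne_top h1,
    fun g hg hg0 Q hQ hQ0 hQp => ?_⟩
  rw [lintegral_mul_exp_neg_quadratic volume hg hg0 hQ hQ0 hQp, sphereMeasure,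
    lintegral_smul_measure, finrank_real_euclideanSpace, smul_eq_mul, mul_assoc,
    ← mul_assoc (σ Set.univ), ENNReal.mul_inv_cancel h0 h1, one_mul]
  push_cast
  rw [mul_div_cancel_left₀ _ (two_ne_zero' ℝ)]

/-- The uniform measure integrates the `-N`-th power of a positive diagonal form to the inverse
of its determinant, in any orthonormal basis. -/
lemma lintegral_sphereMeasure_rpow_neg {N : ℕ} (hN : 1 ≤ N) {c : Fin N → ℝ} (hc : ∀ i, 0 < c i)
    (b : OrthonormalBasis (Fin N) ℂ (EuclideanSpace ℂ (Fin N))) :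
    ∫⁻ u : UnitSphere N, ENNReal.ofReal ((∑ i, c i * ‖b.repr u.1 i‖ ^ 2) ^ (-(N : ℝ)))
      ∂(sphereMeasure N) = ENNReal.ofReal (∏ i, (c i)⁻¹) := by
  obtain ⟨K, hK0, hK1, hK⟩ := exists_lintegral_sphereMeasure hN
  obtain ⟨K', hK'⟩ := exists_lintegral_exp_neg N
  let U : EuclideanSpace ℂ (Fin N) ≃ₗᵢ[ℝ] EuclideanSpace ℂ (Fin N) :=
    b.repr.toIsometryEquiv.toRealLinearIsometryEquivOfMapZero b.repr.map_zero
  have hU : ∀ x, U x = b.repr x := fun x => rfl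
  have hUm := U.measurePreserving
  have key : ∀ d : Fin N → ℝ, (∀ i, 0 < d i) → K' * ENNReal.ofReal (∏ i, (d i)⁻¹) =
      K * ∫⁻ u : UnitSphere N, ENNReal.ofReal ((∑ i, d i * ‖b.repr u.1 i‖ ^ 2) ^ (-(N : ℝ)))
      ∂(sphereMeasure N) := by
    intro d hd
    rw [← hK' d hd, ← hUm.lintegral_comp (by fun_prop)]
    have := hK 1 measurable_one (fun _ _ _ => rfl) (fun x => ∑ i, d i * ‖b.repr x i‖ ^ 2)
      (by
        have : Measurable fun x => ∑ i, d i * ‖U x i‖ ^ 2 := by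
          have := U.continuous.measurable
          fun_prop
        exact this)
      (fun r x => by
        rw [← hU, map_smul, Finset.mul_sum]
        refine Finset.sum_congr rfl fun i _ => ?_
        rw [PiLp.smul_apply, norm_smul, Real.norm_eq_abs, mul_pow, sq_abs, hU]
        ring)
      (fun x hx => by
        have h1 : ‖b.repr x‖ ^ 2 = 1 := by rw [b.repr.norm_map, hx, one_pow]
        rw [EuclideanSpace.norm_sq_eq] at h1
        by_contra! h
        have h2 := (Finset.sum_eq_zero_iff_of_nonneg (fun i _ =>
          mul_nonneg (hd i).le (sq_nonneg ‖b.repr x i‖))).1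
          (le_antisymm h (Finset.sum_nonneg fun i _ => mul_nonneg (hd i).le (sq_nonneg _)))
        have h3 : ∑ i, ‖b.repr x i‖ ^ 2 = 0 := Finset.sum_eq_zero fun i hi => by
          rcases mul_eq_zero.1 (h2 i hi) with h | h
          · exact absurd h (hd i).ne'
          · exact h
        rw [h3] at h1
        exact zero_ne_one h1)
    simpa only [Pi.one_apply, one_mul, hU] using this
  -- With all coefficients `1` the form is `1` on the sphere, which has mass `1`.
  have h1 : K' = K := by
    have h := key (fun _ => 1) (fun _ => one_pos)
    have h2 : ∀ u : UnitSphere N, (∑ i, 1 * ‖b.repr u.1 i‖ ^ 2) = 1 := fun u => by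
      simp_rw [one_mul]
      rw [← EuclideanSpace.norm_sq_eq, b.repr.norm_map]
      simp
    simp_rw [h2] at h
    simpa [sphereMeasure_univ hN] using h
  have h2 := key c hc
  rw [h1] at h2
  exact ((ENNReal.mul_right_inj hK0 hK1).1 h2).symm

/-- The uniform measure is invariant under isometries fixing the origin, tested on homogeneous
functions of degree `0`. -/
lemma lintegral_sphereMeasure_comp_isometry {N : ℕ} (hN : 1 ≤ N)
    (U : EuclideanSpace ℂ (Fin N) ≃ₗᵢ[ℝ] EuclideanSpace ℂ (Fin N))
    {g : EuclideanSpace ℂ (Fin N) → ENNReal} (hg : Measurable g)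
    (hg0 : ∀ (r : ℝ) (x : EuclideanSpace ℂ (Fin N)), 0 < r → g (r • x) = g x) :
    ∫⁻ u : UnitSphere N, g (U u) ∂(sphereMeasure N) = ∫⁻ u : UnitSphere N, g u ∂(sphereMeasure N) := by
  obtain ⟨K, hK0, hK1, hK⟩ := exists_lintegral_sphereMeasure hN
  have hU := U.continuous.measurable
  have key : ∀ f : EuclideanSpace ℂ (Fin N) → ENNReal, Measurable f →
      (∀ (r : ℝ) (x : EuclideanSpace ℂ (Fin N)), 0 < r → f (r • x) = f x) →
      ∫⁻ x, f x * ENNReal.ofReal (Real.exp (-‖x‖ ^ 2)) =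
        K * ∫⁻ u : UnitSphere N, f u ∂(sphereMeasure N) := by
    intro f hf hf0
    rw [hK f hf hf0 (fun x => ‖x‖ ^ 2) (by fun_prop)
      (fun r x => by rw [norm_smul, mul_pow, Real.norm_eq_abs, sq_abs])
      (fun x hx => by rw [hx]; norm_num)]
    simp
  rw [← ENNReal.mul_right_inj hK0 hK1, ← key g hg hg0,
    ← key (fun x => g (U x)) (hg.comp hU) (fun r x hr => by rw [map_smul, hg0 r _ hr]),
    ← U.measurePreserving.lintegral_comp
      (f := fun x => g x * ENNReal.ofReal (Real.exp (-‖x‖ ^ 2))) (by fun_prop)]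
  simp_rw [U.norm_map]

/-! ### Spectrum of the real part of the Jordan nilpotent -/

section Eigenbasis

variable {n : Type*} [Fintype n] [DecidableEq n] {A : Matrix n n ℂ}

lemma inner_eigenvectorBasis_mulVec (hA : A.IsHermitian) (i : n) (x : EuclideanSpace ℂ n) :
    inner ℂ (hA.eigenvectorBasis i) (WithLp.toLp 2 (A.mulVec x.ofLp)) =
      hA.eigenvalues i * inner ℂ (hA.eigenvectorBasis i) x := by
  rw [EuclideanSpace.inner_eq_star_dotProduct, EuclideanSpace.inner_eq_star_dotProduct]
  have h : A.mulVec x.ofLp ⬝ᵥ star (hA.eigenvectorBasis i).ofLp =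
      x.ofLp ⬝ᵥ star (A.mulVec (hA.eigenvectorBasis i).ofLp) := by
    rw [Matrix.star_mulVec, hA.eq, dotProduct_comm, Matrix.dotProduct_mulVec, dotProduct_comm]
  rw [h, hA.mulVec_eigenvectorBasis]
  simp [dotProduct_smul]

lemma dotProduct_mulVec_eq_sum_eigenvalues (hA : A.IsHermitian) (x : EuclideanSpace ℂ n) :
    star x.ofLp ⬝ᵥ A.mulVec x.ofLp =
      ((∑ i, hA.eigenvalues i * ‖hA.eigenvectorBasis.repr x i‖ ^ 2 : ℝ) : ℂ) := by
  have h : star x.ofLp ⬝ᵥ A.mulVec x.ofLp = inner ℂ x (WithLp.toLp 2 (A.mulVec x.ofLp)) := by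
    rw [EuclideanSpace.inner_eq_star_dotProduct, dotProduct_comm]
  rw [h, ← hA.eigenvectorBasis.sum_inner_mul_inner]
  push_cast
  refine Finset.sum_congr rfl fun i _ => ?_
  rw [inner_eigenvectorBasis_mulVec, OrthonormalBasis.repr_apply_apply, ← inner_conj_symm x,
    mul_left_comm, Complex.conj_mul']

/-- If `c` were missing from the list, every coordinate of `v` in the eigenbasis would vanish. -/
lemma exists_eigenvalues_eq (hA : A.IsHermitian) {v : n → ℂ} (hv : v ≠ 0) {c : ℝ}
    (h : A.mulVec v = (c : ℂ) • v) : ∃ i, hA.eigenvalues i = c := by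
  by_contra! hne
  refine hv ?_
  have h0 : WithLp.toLp 2 v = (0 : EuclideanSpace ℂ n) := by
    rw [← hA.eigenvectorBasis.repr.map_eq_zero_iff]
    ext i
    have h1 := inner_eigenvectorBasis_mulVec hA i (WithLp.toLp 2 v)
    simp only [h, WithLp.toLp_smul, inner_smul_right] at h1
    rw [OrthonormalBasis.repr_apply_apply]
    have h2 : ((hA.eigenvalues i : ℂ) - c) ≠ 0 := by
      rw [sub_ne_zero]; exact_mod_cast hne i
    exact (mul_eq_zero.1 (show ((hA.eigenvalues i : ℂ) - c) *
      inner ℂ (hA.eigenvectorBasis i) (WithLp.toLp 2 v) = 0 by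
        rw [sub_mul, ← h1, sub_self])).resolve_left h2
  simpa using h0

end Eigenbasis

/-- The real part of the Jordan nilpotent. -/
noncomputable def jordanRe (N : ℕ) : Matrix (Fin N) (Fin N) ℂ :=
  (1 / 2 : ℂ) • (jordanNilpotent N + (jordanNilpotent N).conjTranspose)

lemma isHermitian_jordanRe (N : ℕ) : (jordanRe N).IsHermitian := by
  rw [jordanRe, Matrix.IsHermitian, Matrix.conjTranspose_smul, Matrix.conjTranspose_add,
    Matrix.conjTranspose_conjTranspose, add_comm]
  congr 1
  simp

lemma re_quadForm (N : ℕ) (u : UnitSphere N) :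
    (quadForm (jordanNilpotent N) u).re =
      ∑ i, (isHermitian_jordanRe N).eigenvalues i *
        ‖(isHermitian_jordanRe N).eigenvectorBasis.repr u.1 i‖ ^ 2 := by
  have h := dotProduct_mulVec_eq_sum_eigenvalues (isHermitian_jordanRe N) u.1
  have h2 : star u.1.ofLp ⬝ᵥ (jordanNilpotent N).conjTranspose.mulVec u.1.ofLp =
      star (quadForm (jordanNilpotent N) u) := by
    rw [quadForm, Matrix.star_dotProduct, Matrix.star_mulVec,
      Matrix.conjTranspose_conjTranspose, ← Matrix.dotProduct_mulVec]
  have h3 : star u.1.ofLp ⬝ᵥ (jordanRe N).mulVec u.1.ofLp = (1 / 2 : ℂ) *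
      (quadForm (jordanNilpotent N) u + (starRingEnd ℂ) (quadForm (jordanNilpotent N) u)) := by
    rw [jordanRe, Matrix.smul_mulVec, Matrix.add_mulVec, dotProduct_smul, dotProduct_add, h2]
    rfl
  rw [h3, Complex.add_conj] at h
  rw [← Complex.ofReal_inj, ← h]
  push_cast
  ring

/-- The angle `kπ / (N + 1)`. -/
noncomputable def angle (N k : ℕ) : ℝ := k * Real.pi / ((N : ℝ) + 1)

/-- Discrete sine waves: `sin (jθ)` vanishes at `j = 0` and `j = N + 1`, so the truncation of the
shifts at both ends is invisible, and the average of the two neighbours is `cos θ` times the middle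
value. -/
lemma jordanRe_mulVec (N k : ℕ) :
    (jordanRe N).mulVec (fun j => ((Real.sin (((j : ℕ) + 1) * angle N k) : ℝ) : ℂ)) =
      ((Real.cos (angle N k) : ℝ) : ℂ) •
        fun j : Fin N => ((Real.sin (((j : ℕ) + 1) * angle N k) : ℝ) : ℂ) := by
  have hend : Real.sin (((N : ℝ) + 1) * angle N k) = 0 := by
    rw [angle, mul_div_cancel₀ _ (by positivity)]
    exact Real.sin_nat_mul_pi k
  set s : ℕ → ℂ := fun j => ((Real.sin (j * angle N k) : ℝ) : ℂ) with hs
  have hv : (fun j : Fin N => ((Real.sin (((j : ℕ) + 1) * angle N k) : ℝ) : ℂ)) =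
      fun j : Fin N => s (j + 1) := by
    ext j; simp [hs]
  rw [hv]
  have hs0 : s 0 = 0 := by simp [hs]
  have hsN : s (N + 1) = 0 := by simp only [hs]; push_cast; exact_mod_cast hend
  have h1 : ∀ i : Fin N, (jordanNilpotent N).mulVec (fun j : Fin N => s (j + 1)) i = s (i + 2) := by
    intro i
    simp only [Matrix.mulVec, dotProduct, jordanNilpotent, Matrix.of_apply, ite_mul, one_mul,
      zero_mul]
    by_cases hi : (i : ℕ) + 1 < N
    · rw [Finset.sum_eq_single ⟨i + 1, hi⟩]
      · simp
      · intro j _ hj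
        rw [if_neg]
        intro h; exact hj (Fin.ext h.symm)
      · simp
    · have : (i : ℕ) + 2 = N + 1 := by omega
      rw [this, hsN]
      refine Finset.sum_eq_zero fun j _ => if_neg ?_
      omega
  have h2 : ∀ i : Fin N, (jordanNilpotent N).conjTranspose.mulVec
      (fun j : Fin N => s (j + 1)) i = s i := by
    intro i
    simp only [Matrix.mulVec, dotProduct, jordanNilpotent, Matrix.conjTranspose_apply,
      Matrix.of_apply, apply_ite star, star_one, star_zero, ite_mul, one_mul, zero_mul]
    rcases Nat.eq_zero_or_pos (i : ℕ) with hi | hi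
    · rw [hi, hs0]
      refine Finset.sum_eq_zero fun j _ => if_neg ?_
      omega
    · rw [Finset.sum_eq_single ⟨i - 1, by omega⟩]
      · simp [Nat.sub_add_cancel hi]
      · intro j _ hj
        rw [if_neg]
        intro h; exact hj (Fin.ext (by simp; omega))
      · simp
  ext i
  rw [jordanRe, Matrix.smul_mulVec, Matrix.add_mulVec, Pi.smul_apply, Pi.add_apply, h1, h2,
    Pi.smul_apply, smul_eq_mul, smul_eq_mul]
  have e1 : ((i : ℕ) + 2 : ℝ) * angle N k = ((i : ℕ) + 1) * angle N k + angle N k := by ring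
  have e2 : ((i : ℕ) : ℝ) * angle N k = ((i : ℕ) + 1) * angle N k - angle N k := by ring
  have e3 : 1 / 2 * (Real.sin (((i : ℕ) + 2 : ℝ) * angle N k) + Real.sin ((i : ℕ) * angle N k)) =
      Real.cos (angle N k) * Real.sin (((i : ℕ) + 1 : ℝ) * angle N k) := by
    rw [e1, e2, Real.sin_add, Real.sin_sub]
    ring
  have e4 := congrArg Complex.ofReal e3
  simp only [hs]
  push_cast at e4 ⊢
  exact e4

lemma angle_mem {N k : ℕ} (hk : k ∈ Finset.Icc 1 N) : angle N k ∈ Set.Ioo 0 Real.pi := by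
  rw [Finset.mem_Icc] at hk
  have h1 : (1 : ℝ) ≤ k := by exact_mod_cast hk.1
  have h2 : (k : ℝ) ≤ N := by exact_mod_cast hk.2
  have := Real.pi_pos
  constructor
  · unfold angle; positivity
  · rw [angle, div_lt_iff₀ (by positivity)]
    nlinarith

lemma injOn_cos_angle (N : ℕ) : Set.InjOn (fun k => Real.cos (angle N k)) (Finset.Icc 1 N) := by
  intro k hk l hl h
  have h1 := Real.injOn_cos (Set.Ioo_subset_Icc_self (angle_mem hk))
    (Set.Ioo_subset_Icc_self (angle_mem hl)) h
  rw [angle, angle, div_left_inj' (by positivity), mul_left_inj' Real.pi_ne_zero] at h1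
  exact_mod_cast h1

/-- The `N` cosines are distinct eigenvalues, so they exhaust the list, each exactly once. -/
lemma exists_equiv_eigenvalues (N : ℕ) : ∃ e : Fin N ≃ Fin N,
    ∀ k : Fin N, (isHermitian_jordanRe N).eigenvalues (e k) = Real.cos (angle N (k + 1)) := by
  have h : ∀ k : Fin N, ∃ i, (isHermitian_jordanRe N).eigenvalues i =
      Real.cos (angle N (k + 1)) := by
    intro k
    refine exists_eigenvalues_eq _ ?_ (jordanRe_mulVec N (k + 1))
    intro h0
    have h1 := congrFun h0 ⟨0, by have := k.2; omega⟩
    have hm : (k : ℕ) + 1 ∈ Finset.Icc 1 N := by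
      rw [Finset.mem_Icc]; omega
    have h2 := Real.sin_pos_of_mem_Ioo (angle_mem hm)
    simp only [Pi.zero_apply, Complex.ofReal_eq_zero] at h1
    rw [Nat.cast_zero, zero_add, one_mul] at h1
    exact h2.ne' h1
  choose σ hσ using h
  have hinj : Function.Injective σ := by
    intro k l hkl
    have h1 : Real.cos (angle N (k + 1)) = Real.cos (angle N (l + 1)) := by
      rw [← hσ, ← hσ, hkl]
    have := injOn_cos_angle N (by simp) (by simp) h1
    exact Fin.ext (by omega)
  exact ⟨Equiv.ofBijective σ (Finite.injective_iff_bijective.1 hinj), hσ⟩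

lemma abs_cos_angle_lt {N k : ℕ} (hk : k ∈ Finset.Icc 1 N) : |Real.cos (angle N k)| < 1 := by
  have h := Real.sin_pos_of_mem_Ioo (angle_mem hk)
  rw [← sq_lt_one_iff_abs_lt_one]
  nlinarith [Real.sin_sq_add_cos_sq (angle N k)]

lemma abs_eigenvalues_lt {N : ℕ} (i : Fin N) : |(isHermitian_jordanRe N).eigenvalues i| < 1 := by
  obtain ⟨e, he⟩ := exists_equiv_eigenvalues N
  rw [← e.apply_symm_apply i, he]
  exact abs_cos_angle_lt (by rw [Finset.mem_Icc]; omega)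

lemma sum_norm_sq_repr {N : ℕ} (u : UnitSphere N) :
    ∑ i, ‖(isHermitian_jordanRe N).eigenvectorBasis.repr u.1 i‖ ^ 2 = 1 := by
  rw [← EuclideanSpace.norm_sq_eq, LinearIsometryEquiv.norm_map]
  simp

lemma abs_re_quadForm_le {N : ℕ} (u : UnitSphere N) :
    |(quadForm (jordanNilpotent N) u).re| ≤ 1 := by
  rw [re_quadForm]
  calc _ ≤ _ := Finset.abs_sum_le_sum_abs _ _
    _ ≤ ∑ i, ‖(isHermitian_jordanRe N).eigenvectorBasis.repr u.1 i‖ ^ 2 := by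
        refine Finset.sum_le_sum fun i _ => ?_
        rw [abs_mul, abs_of_nonneg (sq_nonneg ‖_‖)]
        exact mul_le_of_le_one_left (sq_nonneg _) (abs_eigenvalues_lt i).le
    _ = 1 := sum_norm_sq_repr u

lemma prod_eigenvalues {N : ℕ} (f : ℝ → ℝ) :
    ∏ i, f ((isHermitian_jordanRe N).eigenvalues i) =
      ∏ k ∈ Finset.Icc 1 N, f (Real.cos (angle N k)) := by
  obtain ⟨e, he⟩ := exists_equiv_eigenvalues N
  rw [← e.prod_comp]
  simp_rw [he]
  rw [Fin.prod_univ_eq_prod_range (fun k => f (Real.cos (angle N (k + 1)))),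
    Finset.range_eq_Ico, Finset.prod_Ico_add' (fun k => f (Real.cos (angle N k)))]
  rfl

lemma one_sub_mul_pos {t l : ℝ} (ht : |t| < 1) (hl : |l| ≤ 1) : 0 < 1 - t * l := by
  have : |t * l| < 1 := by
    rw [abs_mul]
    exact (mul_le_of_le_one_right (abs_nonneg _) hl).trans_lt ht
  linarith [le_abs_self (t * l)]

/-- On the unit sphere `1 - tX` is itself a positive diagonal form in the eigenbasis, with
coefficients `1 - t λ_i`. -/
lemma lintegral_one_sub_mul_re_quadForm {N : ℕ} (hN : 1 ≤ N) {t : ℝ} (ht : |t| < 1) :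
    ∫⁻ u, ENNReal.ofReal ((1 - t * (quadForm (jordanNilpotent N) u).re) ^ (-(N : ℝ)))
      ∂(sphereMeasure N) =
      ENNReal.ofReal (∏ k ∈ Finset.Icc 1 N, (1 - t * Real.cos (angle N k))⁻¹) := by
  have h := lintegral_sphereMeasure_rpow_neg hN
    (c := fun i => 1 - t * (isHermitian_jordanRe N).eigenvalues i)
    (fun i => one_sub_mul_pos ht (abs_eigenvalues_lt i).le)
    (isHermitian_jordanRe N).eigenvectorBasis
  rw [prod_eigenvalues (fun x => (1 - t * x)⁻¹)] at h
  rw [← h]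
  refine lintegral_congr fun u => ?_
  congr 2
  rw [re_quadForm, Finset.mul_sum]
  nth_rewrite 1 [← sum_norm_sq_repr u]
  rw [← Finset.sum_sub_distrib]
  exact Finset.sum_congr rfl fun i _ => by ring

/-! ### Partial fractions and Chebyshev polynomials -/

section Lagrange

open Polynomial in
/-- Partial fractions of `∏ i, (1 - t vᵢ)⁻¹`. -/
lemma sum_partialFractions {ι : Type*} [DecidableEq ι] {s : Finset ι} {v : ι → ℝ}
    (hs : s.Nonempty) (hv : Set.InjOn v s) {t : ℝ} (ht : ∀ i ∈ s, 1 - t * v i ≠ 0) :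
    ∑ i ∈ s, v i ^ (s.card - 1) / (∏ j ∈ s.erase i, (v i - v j)) * (1 - t * v i)⁻¹ =
      ∏ i ∈ s, (1 - t * v i)⁻¹ := by
  have hc : 0 < s.card := hs.card_pos
  have hdeg : (X ^ (s.card - 1) : ℝ[X]).degree < s.card := by
    rw [degree_X_pow]; exact_mod_cast Nat.sub_lt hc one_pos
  have hprod : ∏ i ∈ s, (1 - t * v i) ≠ 0 := Finset.prod_ne_zero_iff.2 ht
  -- Lagrange interpolation of `X^(card - 1)` at the nodes `v i`, evaluated at `1/t`; for `t = 0`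
  -- its leading coefficient is compared instead.
  have key : ∑ i ∈ s, v i ^ (s.card - 1) / (∏ j ∈ s.erase i, (v i - v j)) *
      ∏ j ∈ s.erase i, (1 - t * v j) = 1 := by
    rcases eq_or_ne t 0 with rfl | ht0
    · have := Lagrange.coeff_eq_sum hv hdeg
      simp only [coeff_X_pow_self, eval_pow, eval_X] at this
      simp [← this]
    · have h := congrArg (Polynomial.eval t⁻¹) (Lagrange.eq_interpolate hv hdeg)
      simp only [Lagrange.interpolate_apply, eval_pow, eval_X, eval_finsetSum, eval_mul, eval_C,
        Lagrange.basis, eval_prod, Lagrange.basisDivisor, eval_sub] at h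
      have h2 : t ^ (s.card - 1) * t⁻¹ ^ (s.card - 1) = 1 := by
        rw [← mul_pow, mul_inv_cancel₀ ht0, one_pow]
      refine Eq.trans ?_ h2
      rw [h, Finset.mul_sum]
      refine Finset.sum_congr rfl fun i hi => ?_
      have h3 : ∏ j ∈ s.erase i, (1 - t * v j) =
          t ^ (s.card - 1) * ∏ j ∈ s.erase i, (t⁻¹ - v j) := by
        rw [← Finset.card_erase_of_mem hi, ← Finset.prod_const, ← Finset.prod_mul_distrib]
        refine Finset.prod_congr rfl fun j _ => ?_
        rw [mul_sub, mul_inv_cancel₀ ht0]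
      rw [Finset.prod_mul_distrib, Finset.prod_inv_distrib, div_eq_mul_inv, h3]
      ring
  calc _ = ∑ i ∈ s, (v i ^ (s.card - 1) / (∏ j ∈ s.erase i, (v i - v j)) *
        ∏ j ∈ s.erase i, (1 - t * v j)) * (∏ i ∈ s, (1 - t * v i))⁻¹ := by
        refine Finset.sum_congr rfl fun i hi => ?_
        rw [← Finset.mul_prod_erase s _ hi] at hprod ⊢
        have h4 := right_ne_zero_of_mul hprod
        rw [mul_inv, mul_assoc, mul_left_comm (∏ j ∈ s.erase i, (1 - t * v j)),
          mul_inv_cancel₀ h4, mul_one]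
    _ = _ := by rw [← Finset.sum_mul, key, one_mul, Finset.prod_inv_distrib]

end Lagrange

section Chebyshev

open Polynomial

lemma sin_succ_mul_angle (N k : ℕ) : Real.sin (((N : ℝ) + 1) * angle N k) = 0 := by
  rw [angle, mul_div_cancel₀ _ (by positivity)]
  exact Real.sin_nat_mul_pi k

lemma cos_succ_mul_angle (N k : ℕ) : Real.cos (((N : ℝ) + 1) * angle N k) = (-1) ^ k := by
  rw [angle, mul_div_cancel₀ _ (by positivity)]
  exact Real.cos_nat_mul_pi k

lemma eval_U_cos_angle {N k : ℕ} (hk : k ∈ Finset.Icc 1 N) :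
    (Chebyshev.U ℝ N).eval (Real.cos (angle N k)) = 0 := by
  have h := Chebyshev.U_real_cos (angle N k) N
  push_cast at h
  rw [sin_succ_mul_angle] at h
  exact (mul_eq_zero.1 h).resolve_right (Real.sin_pos_of_mem_Ioo (angle_mem hk)).ne'

/-- Differentiate `U_N(cos x) sin x = sin ((N+1)x)` at a root of `U_N(cos x)`. -/
lemma eval_derivative_U_cos_angle {N k : ℕ} (hk : k ∈ Finset.Icc 1 N) :
    (derivative (Chebyshev.U ℝ N)).eval (Real.cos (angle N k)) =
      (-1) ^ (k - 1) * (N + 1) / Real.sin (angle N k) ^ 2 := by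
  have hs := (Real.sin_pos_of_mem_Ioo (angle_mem hk)).ne'
  have h1 : HasDerivAt (fun x => (Chebyshev.U ℝ N).eval (Real.cos x) * Real.sin x)
      ((derivative (Chebyshev.U ℝ N)).eval (Real.cos (angle N k)) * (-Real.sin (angle N k)) *
        Real.sin (angle N k) + (Chebyshev.U ℝ N).eval (Real.cos (angle N k)) *
          Real.cos (angle N k)) (angle N k) :=
    (((Chebyshev.U ℝ N).hasDerivAt _).comp (angle N k) (Real.hasDerivAt_cos _)).mul
      (Real.hasDerivAt_sin _)
  have h2 : HasDerivAt (fun x => Real.sin (((N : ℝ) + 1) * x))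
      (Real.cos (((N : ℝ) + 1) * angle N k) * (((N : ℝ) + 1) * 1)) (angle N k) :=
    ((hasDerivAt_id _).const_mul ((N : ℝ) + 1)).sin
  have h3 : (fun x => (Chebyshev.U ℝ N).eval (Real.cos x) * Real.sin x) =
      fun x => Real.sin (((N : ℝ) + 1) * x) := by
    ext x
    have := Chebyshev.U_real_cos x N
    push_cast at this
    exact this
  rw [h3] at h1
  have h4 := h1.unique h2
  rw [eval_U_cos_angle hk, cos_succ_mul_angle] at h4
  obtain ⟨m, rfl⟩ : ∃ m, k = m + 1 := ⟨k - 1, by rw [Finset.mem_Icc] at hk; omega⟩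
  rw [eq_div_iff (pow_ne_zero 2 hs), Nat.add_sub_cancel]
  rw [pow_succ (-1 : ℝ) m] at h4
  linear_combination -h4

/-- Both sides are monic of degree `N` and vanish at the same `N` distinct nodes. -/
lemma nodal_cos_angle (N : ℕ) :
    Lagrange.nodal (Finset.Icc 1 N) (fun k => Real.cos (angle N k)) =
      C ((2 ^ N : ℝ)⁻¹) * Chebyshev.U ℝ N := by
  have h2 : ((2 ^ N : ℝ)⁻¹) ≠ 0 := by positivity
  have hdeg : (C ((2 ^ N : ℝ)⁻¹) * Chebyshev.U ℝ N).degree = N := by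
    rw [degree_C_mul h2, Chebyshev.degree_U_natCast]
  refine Polynomial.eq_of_degree_le_of_eval_index_eq _ (injOn_cos_angle N) ?_ ?_ ?_ ?_
  · rw [Lagrange.degree_nodal]
  · rw [Lagrange.degree_nodal, hdeg]; simp
  · rw [Lagrange.nodal_monic.leadingCoeff, leadingCoeff_mul, leadingCoeff_C,
      Chebyshev.leadingCoeff_U_natCast, inv_mul_cancel₀ (by positivity)]
  · intro k hk
    rw [Lagrange.eval_nodal_at_node (v := fun k => Real.cos (angle N k)) hk, eval_mul, eval_U_cos_angle hk, mul_zero]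

lemma prod_sub_cos_angle {N k : ℕ} (hk : k ∈ Finset.Icc 1 N) :
    ∏ j ∈ (Finset.Icc 1 N).erase k, (Real.cos (angle N k) - Real.cos (angle N j)) =
      (-1) ^ (k - 1) * (N + 1) / (2 ^ N * Real.sin (angle N k) ^ 2) := by
  have h := Lagrange.eval_nodal_derivative_eval_node_eq
    (v := fun k => Real.cos (angle N k)) hk
  rw [nodal_cos_angle, derivative_C_mul, eval_mul, eval_C, eval_derivative_U_cos_angle hk,
    Lagrange.eval_nodal] at h
  rw [← h, mul_comm ((2 : ℝ) ^ N), ← div_div]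
  ring

end Chebyshev

/-- The coefficient of `(1 - t cos (kπ / (N + 1)))⁻¹` in the partial fraction expansion. -/
noncomputable def partialCoeff (N k : ℕ) : ℝ :=
  (-1) ^ (k - 1) * (2 ^ N / ((N : ℝ) + 1)) * Real.sin (angle N k) ^ 2 *
    Real.cos (angle N k) ^ (N - 1)

lemma sum_partialCoeff {N : ℕ} (hN : 1 ≤ N) {t : ℝ} (ht : |t| < 1) :
    ∑ k ∈ Finset.Icc 1 N, partialCoeff N k * (1 - t * Real.cos (angle N k))⁻¹ =
      ∏ k ∈ Finset.Icc 1 N, (1 - t * Real.cos (angle N k))⁻¹ := by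
  rw [← sum_partialFractions (by simpa using hN) (injOn_cos_angle N) fun k hk =>
    (one_sub_mul_pos ht (abs_cos_angle_lt hk).le).ne']
  refine Finset.sum_congr rfl fun k hk => ?_
  congr 1
  have hs := (Real.sin_pos_of_mem_Ioo (angle_mem hk)).ne'
  have h1 : ((-1 : ℝ) ^ (k - 1)) * (-1) ^ (k - 1) = 1 := by
    rw [← mul_pow]; norm_num
  have h1' : ((-1 : ℝ) ^ (k - 1)) ≠ 0 := by positivity
  rw [prod_sub_cos_angle hk, partialCoeff, Nat.card_Icc, Nat.add_sub_cancel, eq_div_iff (by positivity)]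
  field_simp
  linear_combination (Real.cos (angle N k)) ^ (N - 1) * h1

/-! ### Moments of the real part, by comparing power series -/

section PowerSeries

lemma eq_of_hasSum_pow {a b : ℕ → ℝ} {f : ℝ → ℝ}
    (ha : ∀ t : ℝ, |t| < 1 → HasSum (fun n => a n * t ^ n) (f t))
    (hb : ∀ t : ℝ, |t| < 1 → HasSum (fun n => b n * t ^ n) (f t)) : a = b := by
  set d : ℕ → ℝ := fun n => a n - b n with hd
  have h0 : ∀ t : ℝ, |t| < 1 → HasSum (fun n => d n * t ^ n) 0 := by
    intro t ht
    have := (ha t ht).sub (hb t ht)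
    simpa only [sub_self, ← sub_mul] using this
  have hps : HasFPowerSeriesOnBall (fun _ : ℝ => (0 : ℝ))
      (FormalMultilinearSeries.ofScalars ℝ d) 0 1 := by
    refine ⟨ENNReal.le_of_forall_nnreal_lt fun r hr => ?_, one_pos, fun {y} hy => ?_⟩
    · refine FormalMultilinearSeries.le_radius_of_summable _ ?_
      have hr' : |(r : ℝ)| < 1 := by
        rw [abs_of_nonneg r.coe_nonneg]; exact_mod_cast hr
      refine (h0 r hr').summable.norm.congr fun n => ?_
      rw [FormalMultilinearSeries.ofScalars_norm]
      simp
    · rw [Metric.mem_eball, edist_zero_right] at hy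
      have hy' : |y| < 1 := by
        rw [Real.enorm_eq_ofReal_abs] at hy
        exact ENNReal.ofReal_lt_one.1 hy
      simpa [FormalMultilinearSeries.ofScalars_apply_eq, mul_comm] using h0 y hy'
  have hz := hps.hasFPowerSeriesAt.eq_zero
  ext n
  have h1 := congrArg (fun p : FormalMultilinearSeries ℝ ℝ ℝ => p n fun _ => 1) hz
  simp [hd] at h1
  linarith

end PowerSeries

lemma hasSum_integral_one_sub_rpow {Ω : Type*} [MeasurableSpace Ω] {ρ : Measure Ω}
    [IsFiniteMeasure ρ] {X : Ω → ℝ} (hX : Measurable X) (hX1 : ∀ u, |X u| ≤ 1) (b : ℝ) (hb : 0 < b)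
    {t : ℝ} (ht : |t| < 1) :
    HasSum (fun n : ℕ => ((ascPochhammer ℝ n).eval b / n.factorial * ∫ u, X u ^ n ∂ρ) * t ^ n)
      (∫ u, (1 - t * X u) ^ (-b) ∂ρ) := by
  have hP : ∀ n : ℕ, 0 < (ascPochhammer ℝ n).eval b := fun n => ascPochhammer_pos n _ hb
  have htX : ∀ u, |t * X u| < 1 := fun u => by
    rw [abs_mul]
    exact (mul_le_of_le_one_right (abs_nonneg _) (hX1 u)).trans_lt ht
  have h : HasSum (fun n : ℕ => ∫ u, (ascPochhammer ℝ n).eval b / n.factorial * (t * X u) ^ n ∂ρ)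
      (∫ u, (1 - t * X u) ^ (-b) ∂ρ) := by
    refine hasSum_integral_of_dominated_convergence
      (fun n _ => (ascPochhammer ℝ n).eval b / n.factorial * |t| ^ n)
      (fun n => (by fun_prop : Measurable _).aestronglyMeasurable) (fun n => ?_)
      (Filter.Eventually.of_forall fun x =>
        (hasSum_one_sub_rpow_neg b (by rwa [abs_abs])).summable)
      (integrable_const _) (Filter.Eventually.of_forall fun u => hasSum_one_sub_rpow_neg b (htX u))
    refine Filter.Eventually.of_forall fun u => ?_
    have := hP n
    rw [norm_mul, norm_pow, Real.norm_eq_abs, Real.norm_eq_abs, abs_of_pos (by positivity), abs_mul]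
    gcongr
    exact mul_le_of_le_one_right (abs_nonneg _) (hX1 u)
  convert! h using 2 with n
  rw [← integral_const_mul, ← integral_mul_const]
  congr 1
  ext u
  ring

lemma measurable_quadForm {N : ℕ} (M : Matrix (Fin N) (Fin N) ℂ) : Measurable (quadForm M) := by
  unfold quadForm
  have : Continuous fun u : UnitSphere N => star u.1.ofLp ⬝ᵥ M.mulVec u.1.ofLp := by
    fun_prop
  exact this.measurable

instance {N : ℕ} : IsFiniteMeasure (sphereMeasure N) := by
  rcases Nat.eq_zero_or_pos N with rfl | hN
  · refine ⟨?_⟩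
    have : (Set.univ : Set (UnitSphere 0)) = ∅ := by
      ext u
      have h1 : u.1 = 0 := Subsingleton.elim _ _
      have h2 : ‖u.1‖ = 1 := by simp
      rw [h1, norm_zero] at h2
      exact absurd h2 zero_ne_one
    rw [this]
    simp
  · exact ⟨by rw [sphereMeasure_univ hN]; exact ENNReal.one_lt_top⟩

/-- The moments of the real part of the quadratic form of the Jordan nilpotent. -/
lemma integral_re_quadForm_pow {N : ℕ} (hN : 1 ≤ N) (n : ℕ) :
    (ascPochhammer ℝ n).eval (N : ℝ) / n.factorial *
      ∫ u, (quadForm (jordanNilpotent N) u).re ^ n ∂(sphereMeasure N) =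
        ∑ k ∈ Finset.Icc 1 N, partialCoeff N k * Real.cos (angle N k) ^ n := by
  have hm : Measurable fun u => (quadForm (jordanNilpotent N) u).re :=
    Complex.measurable_re.comp (measurable_quadForm _)
  have h1 := fun (t : ℝ) (ht : |t| < 1) => hasSum_integral_one_sub_rpow (ρ := sphereMeasure N) hm
    abs_re_quadForm_le N (by exact_mod_cast hN) ht
  have h2 : ∀ t : ℝ, |t| < 1 → HasSum (fun n =>
      (∑ k ∈ Finset.Icc 1 N, partialCoeff N k * Real.cos (angle N k) ^ n) * t ^ n)
      (∫ u, (1 - t * (quadForm (jordanNilpotent N) u).re) ^ (-(N : ℝ)) ∂(sphereMeasure N)) := by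
    intro t ht
    have hpos : ∀ u, 0 < 1 - t * (quadForm (jordanNilpotent N) u).re := fun u =>
      one_sub_mul_pos ht (abs_re_quadForm_le u)
    have hval : ∫ u, (1 - t * (quadForm (jordanNilpotent N) u).re) ^ (-(N : ℝ))
        ∂(sphereMeasure N) =
        ∑ k ∈ Finset.Icc 1 N, partialCoeff N k * (1 - t * Real.cos (angle N k))⁻¹ := by
      rw [integral_eq_lintegral_of_nonneg_ae
        (Filter.Eventually.of_forall fun u => Real.rpow_nonneg (hpos u).le _)
        (by fun_prop : Measurable _).aestronglyMeasurable, lintegral_one_sub_mul_re_quadForm hN ht,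
        ENNReal.toReal_ofReal, sum_partialCoeff hN ht]
      exact Finset.prod_nonneg fun k hk =>
        inv_nonneg.2 (one_sub_mul_pos ht (abs_cos_angle_lt hk).le).le
    rw [hval]
    simp_rw [Finset.sum_mul]
    refine hasSum_sum fun k hk => ?_
    have h3 : ‖t * Real.cos (angle N k)‖ < 1 := by
      rw [Real.norm_eq_abs, abs_mul]
      exact (mul_le_of_le_one_right (abs_nonneg _) (abs_cos_angle_lt hk).le).trans_lt ht
    refine ((hasSum_geometric_of_norm_lt_one h3).mul_left (partialCoeff N k)).congr_fun fun n => ?_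
    rw [mul_pow]
    ring
  exact congrFun (eq_of_hasSum_pow h1 h2) n

/-! ### Rotation invariance of the shadow -/

/-- The diagonal unitary with entries `exp (i j θ)`. -/
noncomputable def diagRotation (N : ℕ) (θ : ℝ) :
    EuclideanSpace ℂ (Fin N) ≃ₗᵢ[ℝ] EuclideanSpace ℂ (Fin N) :=
  LinearIsometryEquiv.piLpCongrRight 2 fun j : Fin N => rotation (Circle.exp ((j : ℕ) * θ))

lemma diagRotation_apply {N : ℕ} (θ : ℝ) (x : EuclideanSpace ℂ (Fin N)) (j : Fin N) :
    diagRotation N θ x j = Complex.exp (((j : ℕ) * θ : ℝ) * Complex.I) * x j := rfl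

/-- Nonzero entries of the matrix have `j = i + 1`, so the phases `-iθ` and `jθ` always combine to
`θ`. -/
lemma form_diagRotation {N : ℕ} (θ : ℝ) (x : EuclideanSpace ℂ (Fin N)) :
    star (diagRotation N θ x).ofLp ⬝ᵥ (jordanNilpotent N).mulVec (diagRotation N θ x).ofLp =
      Complex.exp (θ * Complex.I) * (star x.ofLp ⬝ᵥ (jordanNilpotent N).mulVec x.ofLp) := by
  simp only [dotProduct, Matrix.mulVec, Pi.star_apply, Finset.mul_sum]
  refine Finset.sum_congr rfl fun i _ => Finset.sum_congr rfl fun j _ => ?_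
  rw [diagRotation_apply, diagRotation_apply, jordanNilpotent, Matrix.of_apply]
  by_cases hij : (i : ℕ) + 1 = j
  · rw [if_pos hij, ← hij]
    have h1 : star (Complex.exp (((i : ℕ) * θ : ℝ) * Complex.I)) =
        Complex.exp (-(((i : ℕ) * θ : ℝ) * Complex.I)) := by
      rw [Complex.star_def, ← Complex.exp_conj]
      simp
    have h2 : Complex.exp (((i + 1 : ℕ) * θ : ℝ) * Complex.I) =
        Complex.exp (((i : ℕ) * θ : ℝ) * Complex.I) * Complex.exp (θ * Complex.I) := by
      rw [← Complex.exp_add]; congr 1; push_cast; ring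
    have h3 : Complex.exp (-(((i : ℕ) * θ : ℝ) * Complex.I)) *
        Complex.exp (((i : ℕ) * θ : ℝ) * Complex.I) = 1 := by
      rw [← Complex.exp_add, neg_add_cancel, Complex.exp_zero]
    rw [star_mul', h1, h2]
    linear_combination (Complex.exp (θ * Complex.I) * star (x.ofLp i) * x.ofLp j) * h3
  · rw [if_neg hij]; ring

lemma isRotationInvariant_shadow {N : ℕ} (hN : 1 ≤ N) :
    IsRotationInvariant (shadow (jordanNilpotent N)) := by
  intro θ
  have hq := measurable_quadForm (jordanNilpotent N)
  rw [shadow, Measure.map_map (by fun_prop) hq]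
  ext A hA
  rw [Measure.map_apply (by fun_prop) hA, Measure.map_apply hq hA]
  set q : EuclideanSpace ℂ (Fin N) → ℂ := fun x =>
    star x.ofLp ⬝ᵥ (jordanNilpotent N).mulVec x.ofLp with hqdef
  have hqm : Measurable q := by
    have : Continuous q := by rw [hqdef]; fun_prop
    exact this.measurable
  -- Dividing by `‖x‖²` extends the indicator from the sphere to a function homogeneous of degree
  -- `0`, as the isometry lemma requires.
  set g : EuclideanSpace ℂ (Fin N) → ENNReal := fun x =>
    A.indicator (fun _ => 1) (q x / (‖x‖ ^ 2 : ℝ)) with hg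
  have hgm : Measurable g :=
    (measurable_const.indicator hA : Measurable (A.indicator fun _ => (1 : ENNReal))).comp
      (by fun_prop)
  have hg0 : ∀ (r : ℝ) (x : EuclideanSpace ℂ (Fin N)), 0 < r → g (r • x) = g x := by
    intro r x hr
    have h1 : q (r • x) = (r ^ 2 : ℝ) * q x := by
      simp only [hqdef, dotProduct, Matrix.mulVec, Finset.mul_sum]
      refine Finset.sum_congr rfl fun i _ => Finset.sum_congr rfl fun j _ => ?_
      simp
      ring
    have h2 : ((r ^ 2 : ℝ) : ℂ) ≠ 0 := by exact_mod_cast (pow_pos hr 2).ne'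
    simp only [hg]
    rw [h1, norm_smul, mul_pow, Real.norm_eq_abs, sq_abs, Complex.ofReal_mul,
      mul_div_mul_left _ _ h2]
  have hgs : ∀ u : UnitSphere N, g u = (quadForm (jordanNilpotent N) ⁻¹' A).indicator 1 u := by
    intro u
    simp only [hg]
    have : ‖u.1‖ = 1 := by simp
    rw [this, one_pow, Complex.ofReal_one, div_one]
    rfl
  have hgr : ∀ u : UnitSphere N, g (diagRotation N θ u) =
      (((fun z : ℂ => Complex.exp (θ * Complex.I) * z) ∘ quadForm (jordanNilpotent N)) ⁻¹'
        A).indicator 1 u := by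
    intro u
    simp only [hg]
    have h1 : ‖u.1‖ = 1 := by simp
    have h2 : q (diagRotation N θ u.1) = Complex.exp (θ * Complex.I) * q u.1 := form_diagRotation θ _
    rw [LinearIsometryEquiv.norm_map, h1, h2, one_pow, Complex.ofReal_one, div_one]
    rfl
  have h := lintegral_sphereMeasure_comp_isometry hN (diagRotation N θ) hgm hg0
  simp_rw [hgs, hgr] at h
  rwa [lintegral_indicator_one ((by fun_prop : Measurable _) hA), lintegral_indicator_one (hq hA)] at h

/-! ### Real moments of the radial density -/

lemma integral_cos_pow_even_full (m : ℕ) :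
    ∫ x in (-Real.pi)..Real.pi, Real.cos x ^ (2 * m) =
      2 * Real.pi * ((2 * m).factorial / (4 ^ m * (m.factorial : ℝ) ^ 2)) := by
  induction m with
  | zero => simp; ring
  | succ m ih =>
    rw [show 2 * (m + 1) = 2 * m + 2 by ring, integral_cos_pow, ih]
    simp only [Real.sin_pi, Real.sin_neg, mul_zero, sub_zero, neg_zero, zero_div, zero_add]
    rw [Nat.factorial_succ (2 * m + 1), Nat.factorial_succ (2 * m), Nat.factorial_succ m]
    push_cast
    field_simp
    ring

lemma integral_polar {φ : ℝ → ℝ} (n : ℕ) :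
    ∫ z : ℂ, φ ‖z‖ * z.re ^ n = (∫ r in Set.Ioi (0 : ℝ), r ^ (n + 1) * φ r) *
      ∫ x in (-Real.pi)..Real.pi, Real.cos x ^ n := by
  rw [← Complex.integral_comp_polarCoord_symm,
    intervalIntegral.integral_of_le (by linarith [Real.pi_pos]), integral_Ioc_eq_integral_Ioo,
    ← setIntegral_prod_mul]
  rw [show polarCoord.target = Set.Ioi (0 : ℝ) ×ˢ Set.Ioo (-Real.pi) Real.pi from rfl]
  refine setIntegral_congr_fun (measurableSet_Ioi.prod measurableSet_Ioo) fun p hp => ?_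
  have hp0 : (0 : ℝ) < p.1 := hp.1
  simp only [Complex.norm_polarCoord_symm, smul_eq_mul]
  rw [abs_of_pos hp0, Complex.polarCoord_symm_apply]
  have : ((p.1 : ℂ) * (Real.cos p.2 + Real.sin p.2 * Complex.I)).re = p.1 * Real.cos p.2 := by
    simp [Complex.cos_ofReal_re]
  rw [this]
  ring

lemma integral_Ioi_pow_mul_F {N : ℕ} (hN : 2 ≤ N) (m : ℕ) :
    ∫ y in Set.Ioi (0 : ℝ), y ^ m * F N y = shadowMoment N m := by
  have h : ∫ y in Set.Ioi (0 : ℝ), y ^ m * F N y = ∫ y in Set.Ioo (0 : ℝ) 1, y ^ m * F N y := by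
    refine setIntegral_eq_of_subset_of_forall_sdiff_eq_zero measurableSet_Ioi
      Set.Ioo_subset_Ioi_self fun x hx => ?_
    have h0 : (0 : ℝ) < x := hx.1
    rw [F_eq_zero (fun h => hx.2 ⟨h.1, h.2⟩), mul_zero]
  rw [h, integral_pow_mul_F hN]

lemma integral_Ioi_pow_mul_F_sq {N : ℕ} (hN : 2 ≤ N) (m : ℕ) {l : ℝ} (hl : 0 < l) :
    ∫ r in Set.Ioi (0 : ℝ), r ^ (2 * m + 1) * F N (r ^ 2 / l ^ 2) =
      l ^ (2 * m + 2) / 2 * shadowMoment N m := by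
  have h1 := integral_comp_rpow_Ioi_of_pos (g := fun y => y ^ m * F N y) (p := 2) two_pos
  have h2 : ∫ r in Set.Ioi (0 : ℝ), r ^ (2 * m + 1) * F N (r ^ 2) = shadowMoment N m / 2 := by
    rw [← integral_Ioi_pow_mul_F hN, ← h1, ← integral_div]
    refine setIntegral_congr_fun measurableSet_Ioi fun r hr => ?_
    have hr0 : (0 : ℝ) < r := hr
    simp only [Real.rpow_two, smul_eq_mul]
    rw [show (2 : ℝ) - 1 = 1 by norm_num, Real.rpow_one, ← pow_mul]
    ring
  have h3 := integral_comp_mul_left_Ioi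
    (fun r => r ^ (2 * m + 1) * F N (r ^ 2 / l ^ 2)) 0 hl
  have h4 : ∀ x, (l * x) ^ (2 * m + 1) * F N ((l * x) ^ 2 / l ^ 2) =
      l ^ (2 * m + 1) * (x ^ (2 * m + 1) * F N (x ^ 2)) := by
    intro x
    rw [mul_pow l x 2, mul_div_cancel_left₀ _ (by positivity)]
    ring
  simp_rw [h4] at h3
  rw [integral_const_mul, h2, mul_zero, smul_eq_mul, inv_mul_eq_div, eq_div_iff hl.ne'] at h3
  rw [← h3]
  ring

lemma ascPochhammer_two_mul (x : ℝ) (m : ℕ) : (ascPochhammer ℝ (2 * m)).eval x =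
    4 ^ m * ((ascPochhammer ℝ m).eval (x / 2) * (ascPochhammer ℝ m).eval ((x + 1) / 2)) := by
  induction m with
  | zero => simp
  | succ m ih =>
    rw [show 2 * (m + 1) = 2 * m + 1 + 1 by ring, ascPochhammer_succ_eval, ascPochhammer_succ_eval,
      ih, ascPochhammer_succ_eval, ascPochhammer_succ_eval]
    push_cast
    ring

/-- Radial moment times the mean of `cos^(2m)`; the duplication formula for Pochhammer symbols
merges the two half-integer-spaced factors into `(N)_{2m}`. -/
lemma shadowMoment_mul {N : ℕ} (hN : 2 ≤ N) (m : ℕ) :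
    shadowMoment N m * ((2 * m).factorial / (4 ^ m * (m.factorial : ℝ) ^ 2)) =
      (2 * m).factorial / (ascPochhammer ℝ (2 * m)).eval (N : ℝ) := by
  have hN' : (2 : ℝ) ≤ N := by exact_mod_cast hN
  have := ascPochhammer_pos m ((N : ℝ) / 2) (by linarith)
  have := ascPochhammer_pos m (((N : ℝ) + 1) / 2) (by linarith)
  rw [ascPochhammer_two_mul, shadowMoment]
  field_simp

lemma integral_F_mul_re_pow_even {N : ℕ} (hN : 2 ≤ N) (m : ℕ) {l : ℝ} (hl : 0 < l) :
    ∫ z : ℂ, F N (‖z‖ ^ 2 / l ^ 2) * z.re ^ (2 * m) =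
      Real.pi * l ^ (2 * m + 2) * ((2 * m).factorial / (ascPochhammer ℝ (2 * m)).eval (N : ℝ)) := by
  rw [integral_polar (φ := fun r => F N (r ^ 2 / l ^ 2)), integral_Ioi_pow_mul_F_sq hN m hl,
    integral_cos_pow_even_full, ← shadowMoment_mul hN]
  ring

/-- The zeroth moment was computed without assuming integrability and is nonzero, whereas a
non-integrable function would have integral `0`. -/
lemma integrable_F_norm {N : ℕ} (hN : 2 ≤ N) {l : ℝ} (hl : 0 < l) :
    Integrable fun z : ℂ => F N (‖z‖ ^ 2 / l ^ 2) := by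
  by_contra h
  have h1 := integral_F_mul_re_pow_even hN 0 hl
  simp only [mul_zero, pow_zero, mul_one] at h1
  rw [integral_undef h] at h1
  simp [Real.pi_ne_zero, hl.ne'] at h1

lemma integrable_F_norm_mul_re_pow {N : ℕ} (hN : 2 ≤ N) {l : ℝ} (hl : 0 < l) (hl1 : l ≤ 1) (n : ℕ) :
    Integrable fun z : ℂ => F N (‖z‖ ^ 2 / l ^ 2) * z.re ^ n := by
  have hF := measurable_F hN
  refine (integrable_F_norm hN hl).mono (by fun_prop : Measurable _).aestronglyMeasurable
    (Filter.Eventually.of_forall fun z => ?_)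
  rcases le_or_gt ‖z‖ 1 with hz | hz
  · rw [norm_mul, norm_pow]
    exact mul_le_of_le_one_right (norm_nonneg _)
      (pow_le_one₀ (norm_nonneg _) ((Complex.abs_re_le_norm z).trans hz))
  · rw [F_eq_zero, zero_mul]
    rintro ⟨-, h⟩
    rw [div_lt_one (by positivity)] at h
    exact absurd (lt_of_pow_lt_pow_left₀ 2 hl.le h) (by linarith)

lemma cos_angle_pos {N k : ℕ} (hk : k ∈ Finset.Icc 1 (N / 2)) : 0 < Real.cos (angle N k) := by
  rw [Finset.mem_Icc] at hk
  have hm := angle_mem (N := N) (k := k) (by rw [Finset.mem_Icc]; omega)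
  refine Real.cos_pos_of_mem_Ioo ⟨by linarith [hm.1, Real.pi_pos], ?_⟩
  have h2 : 2 * (k : ℝ) ≤ N := by exact_mod_cast (by omega : 2 * k ≤ N)
  rw [angle, div_lt_iff₀ (by positivity)]
  nlinarith [Real.pi_pos]

lemma radialDensity_eq (N : ℕ) (r : ℝ) : radialDensity N r = 1 / Real.pi *
    ∑ k ∈ Finset.Icc 1 (N / 2), (-1 : ℝ) ^ (k - 1) * (2 ^ (N + 1) / ((N : ℝ) + 1)) *
      Real.sin (angle N k) ^ 2 * Real.cos (angle N k) ^ ((N : ℤ) - 3) *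
      F N (r ^ 2 / Real.cos (angle N k) ^ 2) := rfl

lemma angle_reflect {N k : ℕ} (hk : k ∈ Finset.Icc 1 N) :
    angle N (N + 1 - k) = Real.pi - angle N k := by
  rw [Finset.mem_Icc] at hk
  rw [angle, angle, Nat.cast_sub (by omega)]
  push_cast
  field_simp

/-- Folds the sum along `k ↦ N + 1 - k`; a fixed index exists only for odd `N` and must contribute
`0`. -/
lemma sum_Icc_eq_two_mul {N : ℕ} {g : ℕ → ℝ} (hg : ∀ k ∈ Finset.Icc 1 N, g (N + 1 - k) = g k)
    (h0 : ∀ k, 2 * k = N + 1 → g k = 0) :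
    ∑ k ∈ Finset.Icc 1 N, g k = 2 * ∑ k ∈ Finset.Icc 1 (N / 2), g k := by
  rw [← Finset.sum_filter_add_sum_filter_not (Finset.Icc 1 N) (fun k => 2 * k < N + 1)]
  have e1 : (Finset.Icc 1 N).filter (fun k => 2 * k < N + 1) = Finset.Icc 1 (N / 2) := by
    ext k; simp only [Finset.mem_filter, Finset.mem_Icc]; omega
  have e2 : ∑ k ∈ (Finset.Icc 1 N).filter (fun k => ¬ 2 * k < N + 1), g k =
      ∑ k ∈ Finset.Icc 1 (N / 2), g k := by
    rw [← Finset.sum_filter_add_sum_filter_not _ (fun k => 2 * k = N + 1),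
      Finset.sum_eq_zero (fun k hk => h0 k (Finset.mem_filter.1 hk).2), zero_add]
    refine Finset.sum_nbij' (fun k => N + 1 - k) (fun k => N + 1 - k) ?_ ?_ ?_ ?_ ?_
    · intro k hk; simp only [Finset.mem_filter, Finset.mem_Icc] at hk ⊢; omega
    · intro k hk; simp only [Finset.mem_filter, Finset.mem_Icc] at hk ⊢; omega
    · intro k hk; simp only [Finset.mem_filter, Finset.mem_Icc] at hk ⊢; omega
    · intro k hk; simp only [Finset.mem_Icc] at hk ⊢; omega
    · intro k hk
      exact (hg k (Finset.mem_filter.1 (Finset.mem_filter.1 hk).1).1).symm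
  rw [e1, e2]
  ring

lemma sum_partialCoeff_mul_pow_even {N : ℕ} (hN : 2 ≤ N) (m : ℕ) :
    ∑ k ∈ Finset.Icc 1 N, partialCoeff N k * Real.cos (angle N k) ^ (2 * m) =
      2 * ∑ k ∈ Finset.Icc 1 (N / 2), partialCoeff N k * Real.cos (angle N k) ^ (2 * m) := by
  refine sum_Icc_eq_two_mul (fun k hk => ?_) fun k hk => ?_
  · rw [partialCoeff, partialCoeff, angle_reflect hk, Real.cos_pi_sub, Real.sin_pi_sub,
      neg_pow _ (N - 1), neg_pow _ (2 * m), pow_mul (-1 : ℝ) 2 m]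
    rw [Finset.mem_Icc] at hk
    -- The sign `(-1)^(N-1)` from the reflected cosine offsets the change in the alternating sign.
    have h1 : ((-1 : ℝ)) ^ (N + 1 - k - 1) * (-1) ^ (N - 1) = (-1) ^ (k - 1) := by
      rw [← pow_add]
      have : N + 1 - k - 1 + (N - 1) + 2 * (k - 1) = 2 * (N - 1) + (k - 1) := by omega
      have h2 := congrArg (fun j => (-1 : ℝ) ^ j) this
      simp only [pow_add _ _ (2 * _), pow_add _ (2 * _), pow_mul (-1 : ℝ) 2, neg_one_sq, one_pow,
        mul_one, one_mul] at h2
      exact h2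
    rw [← h1, neg_one_sq, one_pow, one_mul]
    ring
  -- The middle coefficient contains `cos (π/2)` to the power `N - 1`, which is positive since `N ≥
  -- 2`.
  · have h1 : angle N k = Real.pi / 2 := by
      have : (2 : ℝ) * k = N + 1 := by exact_mod_cast hk
      rw [angle, ← this]
      have : (k : ℝ) ≠ 0 := by intro h; rw [h] at this; linarith [Nat.cast_nonneg (α := ℝ) N]
      field_simp
    rw [partialCoeff, h1, Real.cos_pi_div_two, zero_pow (by omega)]
    ring

lemma measurable_radialDensity {N : ℕ} (hN : 2 ≤ N) : Measurable (radialDensity N) := by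
  have hF := measurable_F hN
  unfold radialDensity
  fun_prop

lemma radialDensity_mul_eq (N : ℕ) (z : ℂ) (n : ℕ) :
    radialDensity N ‖z‖ * z.re ^ n = ∑ k ∈ Finset.Icc 1 (N / 2), 1 / Real.pi *
      ((-1 : ℝ) ^ (k - 1) * (2 ^ (N + 1) / ((N : ℝ) + 1)) *
      Real.sin (angle N k) ^ 2 * Real.cos (angle N k) ^ ((N : ℤ) - 3)) *
      (F N (‖z‖ ^ 2 / Real.cos (angle N k) ^ 2) * z.re ^ n) := by
  rw [radialDensity_eq, mul_assoc, Finset.sum_mul, Finset.mul_sum]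
  refine Finset.sum_congr rfl fun k _ => ?_
  ring

lemma integrable_radialDensity {N : ℕ} (hN : 2 ≤ N) :
    Integrable fun z : ℂ => radialDensity N ‖z‖ := by
  have h := fun z : ℂ => radialDensity_mul_eq N z 0
  simp only [pow_zero, mul_one] at h
  simp_rw [h]
  exact integrable_finsetSum _ fun k hk => (integrable_F_norm hN (cos_angle_pos hk)).const_mul _

lemma radialDensity_eq_zero {N : ℕ} {r : ℝ} (hr : 1 < r) : radialDensity N r = 0 := by
  rw [radialDensity_eq, Finset.sum_eq_zero, mul_zero]
  intro k hk
  rw [F_eq_zero, mul_zero]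
  rintro ⟨-, h⟩
  have hc := cos_angle_pos hk
  rw [div_lt_one (by positivity)] at h
  have := lt_of_pow_lt_pow_left₀ 2 hc.le h
  linarith [Real.cos_le_one (angle N k)]

lemma integral_radialDensity_mul_re_pow_even {N : ℕ} (hN : 2 ≤ N) (m : ℕ) :
    ∫ z : ℂ, radialDensity N ‖z‖ * z.re ^ (2 * m) =
      (2 * m).factorial / (ascPochhammer ℝ (2 * m)).eval (N : ℝ) *
        ∑ k ∈ Finset.Icc 1 N, partialCoeff N k * Real.cos (angle N k) ^ (2 * m) := by
  simp_rw [radialDensity_mul_eq]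
  rw [integral_finsetSum _ fun k hk => (integrable_F_norm_mul_re_pow hN (cos_angle_pos hk)
    (Real.cos_le_one _) _).const_mul _, sum_partialCoeff_mul_pow_even hN, Finset.mul_sum,
    Finset.mul_sum]
  refine Finset.sum_congr rfl fun k hk => ?_
  have hc := cos_angle_pos hk
  rw [integral_const_mul, integral_F_mul_re_pow_even hN m hc, partialCoeff]
  -- The scaling factor `l^(2m+2)` restores the exponent `N - 1` of the partial fractions; integer
  -- powers are needed because `N - 3` is `-1` when `N = 2`.
  have h1 : Real.cos (angle N k) ^ ((N : ℤ) - 3) * Real.cos (angle N k) ^ (2 * m + 2) =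
      Real.cos (angle N k) ^ (N - 1) * Real.cos (angle N k) ^ (2 * m) := by
    rw [← zpow_natCast, ← zpow_natCast, ← zpow_natCast, ← zpow_add₀ hc.ne', ← zpow_add₀ hc.ne']
    congr 1
    rw [Nat.cast_sub (by omega)]
    push_cast
    ring
  have hpi := Real.pi_ne_zero
  calc _ = ((1 / Real.pi) * Real.pi) * ((-1 : ℝ) ^ (k - 1) * (2 ^ (N + 1) / ((N : ℝ) + 1)) *
      Real.sin (angle N k) ^ 2 * (Real.cos (angle N k) ^ ((N : ℤ) - 3) *
        Real.cos (angle N k) ^ (2 * m + 2)) *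
          ((2 * m).factorial / (ascPochhammer ℝ (2 * m)).eval (N : ℝ))) := by ring
    _ = _ := by rw [h1, one_div_mul_cancel hpi, pow_succ]; ring

/-! ### Odd moments and the density of the shadow -/

lemma integral_re_pow_odd {ρ : Measure ℂ} (hρ : IsRotationInvariant ρ) {n : ℕ} (hn : Odd n) :
    ∫ z, z.re ^ n ∂ρ = 0 := by
  have h : ∫ z, z.re ^ n ∂ρ = -∫ z, z.re ^ n ∂ρ := by
    conv_lhs => rw [← hρ Real.pi]
    rw [integral_map (by fun_prop) (by fun_prop : Measurable _).aestronglyMeasurable,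
      ← integral_neg]
    congr 1
    ext z
    rw [Complex.exp_pi_mul_I, neg_one_mul, Complex.neg_re, hn.neg_pow]
  linarith

lemma integral_radial_mul_re_pow_odd {φ : ℝ → ℝ} {n : ℕ} (hn : Odd n) :
    ∫ z : ℂ, φ ‖z‖ * z.re ^ n = 0 := by
  have h := integral_neg_eq_self (fun z : ℂ => φ ‖z‖ * z.re ^ n) volume
  simp only [norm_neg, Complex.neg_re, hn.neg_pow, mul_neg] at h
  rw [integral_neg] at h
  linarith

lemma hasPlanarDensity_shadow {N : ℕ} (hN : 2 ≤ N) :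
    HasPlanarDensity (shadow (jordanNilpotent N)) (fun z => radialDensity N ‖z‖) := by
  have hq := measurable_quadForm (jordanNilpotent N)
  have hrot := isRotationInvariant_shadow (N := N) (by omega)
  have hm := measurable_radialDensity hN
  have : IsFiniteMeasure (shadow (jordanNilpotent N)) := by
    unfold shadow; infer_instance
  refine hasPlanarDensity_of_re_moments hrot ?_ (by fun_prop) (integrable_radialDensity hN) ?_
    (fun z hz => radialDensity_eq_zero hz) fun n => ?_
  · rw [shadow, ae_map_iff hq.aemeasurable (measurableSet_le (by fun_prop) (by fun_prop))]
    exact Filter.Eventually.of_forall abs_re_quadForm_le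
  · intro θ z
    rw [norm_mul, Complex.norm_exp_ofReal_mul_I, one_mul]
  · rcases Nat.even_or_odd' n with ⟨m, rfl | rfl⟩
    · have hP := ascPochhammer_pos (2 * m) (N : ℝ) (by exact_mod_cast (by omega : 0 < N))
      rw [integral_radialDensity_mul_re_pow_even hN, ← integral_re_quadForm_pow (by omega), shadow,
        integral_map hq.aemeasurable (by fun_prop : Measurable _).aestronglyMeasurable]
      field_simp
    · rw [integral_re_pow_odd hrot (by simp), integral_radial_mul_re_pow_odd (by simp)]

end NumericalShadow

theorem proposition7p3 (N : ℕ) (hN : 2 ≤ N) :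
    -- the shadow of the Jordan nilpotent is rotation invariant, with radial density `f_N`
    (NumericalShadow.IsRotationInvariant
        (NumericalShadow.shadow (NumericalShadow.jordanNilpotent N)) ∧
      NumericalShadow.HasPlanarDensity
        (NumericalShadow.shadow (NumericalShadow.jordanNilpotent N))
        (fun z => NumericalShadow.radialDensity N ‖z‖)) ∧
    -- `F_N` is a density on `[0, 1]` with the prescribed moments, and the only one
    NumericalShadow.IsUnitIntervalDensity (NumericalShadow.F N) ∧
    NumericalShadow.HasShadowMoments N (NumericalShadow.F N) ∧
    (∀ G : ℝ → ℝ, NumericalShadow.IsUnitIntervalDensity G →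
      NumericalShadow.HasShadowMoments N G →
      ∀ᵐ x ∂(MeasureTheory.volume.restrict (Set.Icc (0 : ℝ) 1)), G x = NumericalShadow.F N x) ∧
    -- the hypergeometric form of `F_N`
    (∀ x : ℝ, 0 < x → x < 1 →
      NumericalShadow.F N x =
        Real.Gamma ((N : ℝ) / 2) * Real.Gamma (((N : ℝ) + 1) / 2) / Real.Gamma ((N : ℝ) - 3 / 2) *
          (1 - x) ^ ((N : ℝ) - 5 / 2) *
          ordinaryHypergeometric (((N : ℝ) - 1) / 2) (((N : ℝ) - 2) / 2) ((N : ℝ) - 3 / 2)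
            (1 - x)) := by
  have hF := NumericalShadow.isUnitIntervalDensity_F hN
  have hM := NumericalShadow.hasShadowMoments_F hN
  refine ⟨⟨NumericalShadow.isRotationInvariant_shadow (by omega),
    NumericalShadow.hasPlanarDensity_shadow hN⟩, hF, hM, fun G hG hGM => ?_,
    fun x h0 h1 => NumericalShadow.F_eq_hypergeometric hN h0 h1⟩
  exact NumericalShadow.ae_eq_of_moments hG.1 hF.1 hG.2.1 hF.2.1 fun n => by
    rw [hGM n, hM n]
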